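/- **Setting.** Let $G$ be a finite simple undirected graph with node set $V=\{1,\dots,N\}$ and $M$ edges, and let $K_I\in\mathbb{R}^{M\times N}$ be its (oriented) incidence matrix for an arbitrary orientation of the edges, $K=K_I^{T}$. The consensus dynamics on $G$ are written as the descriptor system in the node states $x\in\mathbb R^N$ and edge states $x^e\in\mathbb R^M$ $$\begin{pmatrix} I&0\\0&0\end{pmatrix}\begin{pmatrix}\dot x\\ \dot x^e\end{pmatrix}=\begin{pmatrix}0&K\\K_I&W\end{pmatrix}\begin{pmatrix}x\\x^e\end{pmatrix},$$ where $W$ is diagonal and its diagonal entries are free parameters. With $n=N+M$, put $$Q_F=\begin{pmatrix} I&0\\0&0\end{pmatrix},\quad Q_A=\begin{pmatrix}0&K\\K_I&0\end{pmatrix},\quad T_A=\begin{pmatrix}0&0\\0&W\end{pmatrix},$$ and for $S\subseteq V$ let $T_B(S)$ be the $n\times n$ diagonal matrix with a free parameter in position $(i,i)$ for each node $i\in S$ and zeros elsewhere. *The matroid $\mathcal M_1$ on $V$* has the rank function $$\rho_1(S)=\operatorname{rank}\bigl(\mathcal M([I|Q_A|0])\vee\mathcal M([I|T_A|T_B(S)])\bigr)-\operatorname{rank}\bigl(\mathcal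 M([I|Q_A|0])\vee\mathcal M([I|T_A|0])\bigr),$$ where $\mathcal M(\cdot)$ is the column matroid (for generic values of the free parameters) and $\vee$ is matroid union. *The matroid $\mathcal M_2$ on $V$.* Let $\Omega$ be the $2n\times n$ matrix with the rows of $Q_A-Q_F$, indexed by $w_i$ and $w_e$ ($i$ a node, $e$ an edge), above the rows of the identity, indexed by $x_i$ and $x_e$. Let $J=\{w_i : i\in V\}\cup\{x_e : e \text{ an edge}\}$, let $\Omega_J$ be the (invertible) submatrix of rows in $J$, and $\tilde\Omega=\Omega\,\Omega_J^{-1}$, with columns indexed by $J$. The auxiliary digraph $G'$ has two vertices $v^T,v^Q$ for every row index $v$ of $\Omega$, and the edges $(x_e^Q,w_e^T)$ and $(w_e^T,w_e^Q)$ for all edges $e$, $(w_i^Q,w_i^T)$ for all nodes $i$, and $(v^Q,y^Q)$ whenever $v\notin J$, $y\in J$ and $\tilde\Omega_{vy}\neq0$. Call a strongly connected component of $G'$ extremal if its vertices lie on directed cycles and no vertex of another component that lies on a cycle can be reached from it. Then $\rho_2(S)$ is the number of extremal components from which some $w_s^T$ with $s\in S$ can be reached, and $\mathcal M_2$ is the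 matroid with rank function $\rho_2$. Let $\mathcal M_j^*$ denote the dual matroid of $\mathcal M_j$. For $f:2^V\to\mathbb R_{\ge 0}$ and $k\in\mathbb N$ consider the problem of selecting input nodes for performance under the controllability constraint, $$\text{maximize } f(S)\quad\text{s.t. } (V\setminus S)\in\mathcal M_1^*\cap\mathcal M_2^*,\ |S|\le k.\tag{1}$$ **Theorem.** (a) There is an algorithm which, given $G$, $k$ and a value oracle for a nonnegative monotone submodular function $f$ of the form $f(S)=\sum_{i=1}^{r}f_i(S\cap V_i)$, where $V_1,\dots,V_r$ are the node sets of the connected components of $G$, halts within a number of steps that is polynomial in $N$ and, whenever (1) has a feasible set, outputs a feasible set $S$ with $f(S)\ge(1-1/e)\,f(S')$ for every feasible $S'$. (b) If $G$ is (strongly) connected, that is, if there is a path between any two nodes, the same holds for every nonnegative monotone submodular function $f$: there is an algorithm which on all such $G$, all $k$ and all such $f$ halts within a number of steps polynomial in $N$ and outputs a feasible set $S$ with $f(S)\ge(1-1/e)\,f(S')$ for every feasible $S'$, whenever (1) has a feasible set. Steps are those of a deterministic random access machine that reads $G$ by adjacency tests and $f$ by the value oracle, compares, adds and subtracts oracle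 values, and in which each elementary instruction, test and oracle call costs one step. -/

import Mathlib

/-! ### Set functions -/

/-- A nonnegative, monotone, submodular set function. -/
structure IsMonotoneSubmodular {V : Type*} [DecidableEq V] (f : Finset V → ℝ) : Prop where
  nonneg : ∀ A, 0 ≤ f A
  mono : ∀ A B, A ⊆ B → f A ≤ f B
  submodular : ∀ A B, A ⊆ B → ∀ v, v ∉ B →
    f (insert v B) - f B ≤ f (insert v A) - f A

open scoped Classical in
/-- `f(S) = ∑ᵢ fᵢ(S ∩ Vᵢ)`, where the `Vᵢ` are the vertex sets of the connected components. -/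
def IsSeparableOverComponents {V : Type*} (G : SimpleGraph V) (f : Finset V → ℝ) : Prop :=
  ∃ g : G.ConnectedComponent → Finset V → ℝ,
    ∀ S, f S = ∑ᶠ c, g c (S.filter (fun v => G.connectedComponentMk v = c))

/-! ### Matroids presented by independent sets or by a rank function -/

/-- The independent sets of the matroid union. -/
def UnionIndep {γ : Type*} [DecidableEq γ] (I₁ I₂ : Finset γ → Prop) (X : Finset γ) : Prop :=
  ∃ X₁ X₂, I₁ X₁ ∧ I₂ X₂ ∧ X = X₁ ∪ X₂

open scoped Classical in
/-- The rank of a matroid: the largest size of an independent set. -/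
noncomputable def indepRank {γ : Type*} [Fintype γ] (I : Finset γ → Prop) : ℕ :=
  (Finset.univ.filter I).sup Finset.card

/-- The independent sets of the matroid with rank function `ρ`. -/
def RankIndep {V : Type*} (ρ : Finset V → ℕ) (X : Finset V) : Prop :=
  ρ X = X.card

/-- The bases of the matroid with rank function `ρ`. -/
def RankBasis {V : Type*} (ρ : Finset V → ℕ) (B : Finset V) : Prop :=
  Maximal (RankIndep ρ) B

/-- The independent sets of the dual of the matroid with rank function `ρ`: the sets contained
in the complement of a basis. -/
def RankDualIndep {V : Type*} [Fintype V] [DecidableEq V] (ρ : Finset V → ℕ)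
    (R : Finset V) : Prop :=
  ∃ B, RankBasis ρ B ∧ R ⊆ Bᶜ

/-! ### Structured descriptor systems -/

/-- A descriptor system `(Q_F + T_F) ẋ = (Q_A + T_A) x`: `QF`, `QA` are the fixed matrices, and
`TF i j`, `TA i j` say that the `(i, j)` entry of `T_F`, `T_A` is a free parameter (the other
entries of `T_F`, `T_A` are zero). -/
structure StructuredSystem (ι : Type*) where
  QF : Matrix ι ι ℝ
  QA : Matrix ι ι ℝ
  TF : ι → ι → Prop
  TA : ι → ι → Prop

namespace StructuredSystem

variable {ι : Type*} [Fintype ι] [DecidableEq ι]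

/-- The matrix `[I | X | Y]`. -/
def augmented (X Y : Matrix ι ι ℝ) : Matrix ι (ι ⊕ (ι ⊕ ι)) ℝ :=
  Matrix.fromCols 1 (Matrix.fromCols X Y)

/-- Independence in the linear matroid of the columns of `M`. -/
def ColIndep {γ : Type*} (M : Matrix ι γ ℝ) (X : Finset γ) : Prop :=
  LinearIndependent ℝ (fun j : X => M.col j)

/-- Independence in the matroid `M([I | Q_A | 0])`. -/
def FixedIndep (sys : StructuredSystem ι) (X : Finset (ι ⊕ (ι ⊕ ι))) : Prop :=
  ColIndep (augmented sys.QA 0) X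

/-- Independence in the matroid `M([I | T_A | T_B(S)])` of a matrix of free parameters, where
`T_B(S)` is diagonal with a free parameter at `(i, i)` for `i ∈ S` and zero elsewhere: the columns
are independent for generic, equivalently for some, values of the parameters. -/
def FreeIndep (sys : StructuredSystem ι) (S : Finset ι) (X : Finset (ι ⊕ (ι ⊕ ι))) : Prop :=
  ∃ TA TB : Matrix ι ι ℝ, (∀ i j, ¬ sys.TA i j → TA i j = 0) ∧
    (∀ i j, ¬ (i = j ∧ i ∈ S) → TB i j = 0) ∧ ColIndep (augmented TA TB) X

/-- `ρ₁(S) = rank(M([I|Q_A|0]) ∨ M([I|T_A|T_B(S)])) - rank(M([I|Q_A|0]) ∨ M([I|T_A|0]))`. -/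
noncomputable def rho₁ (sys : StructuredSystem ι) (S : Finset ι) : ℕ :=
  indepRank (UnionIndep sys.FixedIndep (sys.FreeIndep S)) -
    indepRank (UnionIndep sys.FixedIndep (sys.FreeIndep ∅))

/-- The matrix `Ω` without its input block; `Sum.inl i` is the row `wᵢ` and `Sum.inr i` the
row `xᵢ`. -/
def Omega (sys : StructuredSystem ι) : Matrix (ι ⊕ ι) ι ℝ :=
  Matrix.fromRows (sys.QA - sys.QF) 1

/-- A perfect matching of the bipartite graph `H`, with `m i = Sum.inl i` for `m(wᵢᵀ) = wᵢ^Q` and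
`m i = Sum.inr j` for `m(wᵢᵀ) = xⱼ^Q`, whose set `J` of matched rows is linearly independent
in `Ω`. -/
structure AuxMatching (sys : StructuredSystem ι) where
  m : ι → ι ⊕ ι
  injective : Function.Injective m
  edge : ∀ i, m i = Sum.inl i ∨ ∃ j, (sys.TA i j ∨ sys.TF i j) ∧ m i = Sum.inr j
  independent : LinearIndependent ℝ (fun i => sys.Omega.row (m i))

/-- `Ω Ω_J⁻¹`; the columns are indexed by `J`, column `i` being `m i`. -/
noncomputable def OmegaTilde (sys : StructuredSystem ι) (μ : sys.AuxMatching) :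
    Matrix (ι ⊕ ι) ι ℝ :=
  sys.Omega * (sys.Omega.submatrix μ.m id)⁻¹

/-- The vertices of the auxiliary graph: the copies `wᵢᵀ, xᵢᵀ` and the copies `wᵢ^Q, xᵢ^Q`. -/
abbrev AuxVertex (ι : Type*) := (ι ⊕ ι) ⊕ (ι ⊕ ι)

/-- The vertex `wᵢᵀ`. -/
abbrev wT {ι : Type*} (i : ι) : AuxVertex ι := Sum.inl (Sum.inl i)

/-- The vertex `v^Q` for a row `v` of `Ω`. -/
abbrev vQ {ι : Type*} (v : ι ⊕ ι) : AuxVertex ι := Sum.inr v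

/-- The edges of the auxiliary graph with empty input set. -/
inductive AuxEdge (sys : StructuredSystem ι) (μ : sys.AuxMatching) :
    AuxVertex ι → AuxVertex ι → Prop
  | freeUnmatched (i j : ι) : (sys.TA i j ∨ sys.TF i j) → μ.m i ≠ Sum.inr j →
      AuxEdge sys μ (wT i) (vQ (Sum.inr j))
  | freeMatched (i j : ι) : (sys.TA i j ∨ sys.TF i j) → μ.m i = Sum.inr j →
      AuxEdge sys μ (vQ (Sum.inr j)) (wT i)
  | copyUnmatched (i : ι) : μ.m i ≠ Sum.inl i → AuxEdge sys μ (wT i) (vQ (Sum.inl i))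
  | copyMatched (i : ι) : μ.m i = Sum.inl i → AuxEdge sys μ (vQ (Sum.inl i)) (wT i)
  | fixed (v : ι ⊕ ι) (i : ι) : v ∉ Set.range μ.m → sys.OmegaTilde μ v i ≠ 0 →
      AuxEdge sys μ (vQ v) (vQ (μ.m i))

/-- There is a (possibly empty) directed path from `u` to `v` in the auxiliary graph. -/
def AuxReach (sys : StructuredSystem ι) (μ : sys.AuxMatching) (u v : AuxVertex ι) : Prop :=
  Relation.ReflTransGen (sys.AuxEdge μ) u v

/-- `v` lies on a directed cycle of the auxiliary graph. -/
def AuxOnCycle (sys : StructuredSystem ι) (μ : sys.AuxMatching) (v : AuxVertex ι) : Prop :=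
  Relation.TransGen (sys.AuxEdge μ) v v

/-- The class of `v` under mutual reachability. -/
def auxClass (sys : StructuredSystem ι) (μ : sys.AuxMatching) (v : AuxVertex ι) :
    Set (AuxVertex ι) :=
  {u | sys.AuxReach μ u v ∧ sys.AuxReach μ v u}

/-- The classes of vertices on cycles that are extremal in the acyclic quotient graph: no path
leads from them to another class of vertices on cycles. All vertices on cycles have a path
to `{wₛᵀ : s ∈ S}` iff these classes have one. -/
def extremalClasses (sys : StructuredSystem ι) (μ : sys.AuxMatching) :
    Set (Set (AuxVertex ι)) :=
  {C | ∃ v, sys.AuxOnCycle μ v ∧ C = sys.auxClass μ v ∧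
    ∀ u, sys.AuxOnCycle μ u → sys.AuxReach μ v u → u ∈ C}

/-- `ρ₂(S)`: the number of extremal classes that are connected to the input set `S`, i.e. have a
path to some `wₛᵀ` with `s ∈ S`. -/
noncomputable def rho₂ (sys : StructuredSystem ι) (μ : sys.AuxMatching) (S : Finset ι) : ℕ :=
  Set.ncard {C ∈ sys.extremalClasses μ | ∃ v ∈ C, ∃ s ∈ S, sys.AuxReach μ v (wT s)}

end StructuredSystem

/-! ### The consensus system -/

/-- An orientation of the edges of a graph; it fixes the signs in the incidence matrix. -/
structure EdgeOrientation {V : Type*} (G : SimpleGraph V) where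
  tail : G.edgeSet → V
  head : G.edgeSet → V
  ends : ∀ e, s(tail e, head e) = e.1

namespace Consensus

open StructuredSystem

variable {N : ℕ} {G : SimpleGraph (Fin N)}

/-- The incidence matrix `K_I`, with one row per edge and one column per node. -/
def incidence (o : EdgeOrientation G) : Matrix G.edgeSet (Fin N) ℝ :=
  fun e i => (if i = o.tail e then 1 else 0) - (if i = o.head e then 1 else 0)

/-- The consensus dynamics as a descriptor system in the node states `x` (index `Sum.inl i`) and
the edge states `xᵉ` (index `Sum.inr e`):
`ẋ = K xᵉ`, `0 = K_I x + W xᵉ` with `K = K_Iᵀ` and `W` diagonal with free diagonal entries. -/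
def system (o : EdgeOrientation G) : StructuredSystem (Fin N ⊕ G.edgeSet) where
  QF := Matrix.fromBlocks 1 0 0 0
  QA := Matrix.fromBlocks 0 (incidence o).transpose (incidence o) 0
  TF := fun _ _ => False
  TA := fun a b => ∃ e, a = Sum.inr e ∧ b = Sum.inr e

open scoped Classical in
/-- The matching `m(wᵢᵀ) = wᵢ^Q` for nodes `i` and `m(wₑᵀ) = xₑ^Q` for edges `e`. -/
noncomputable def matching (o : EdgeOrientation G) : (system o).AuxMatching where
  m := Sum.elim (fun i => Sum.inl (Sum.inl i)) (fun e => Sum.inr (Sum.inr e))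
  injective := by
    rintro (i | e) (j | e') h <;> simp_all
  edge := by
    rintro (i | e)
    · exact Or.inl rfl
    · exact Or.inr ⟨Sum.inr e, Or.inl ⟨e, rfl, rfl⟩, rfl⟩
  independent := by
    have h : (system o).Omega.submatrix
        (Sum.elim (fun i => Sum.inl (Sum.inl i)) (fun e => Sum.inr (Sum.inr e))) id =
        Matrix.fromBlocks (-1) (incidence o).transpose 0 1 := by
      ext a b
      rcases a with i | e <;> rcases b with j | e' <;>
        simp [Omega, system, Matrix.one_apply]
    have hu : IsUnit ((system o).Omega.submatrix
        (Sum.elim (fun i => Sum.inl (Sum.inl i)) (fun e => Sum.inr (Sum.inr e))) id) := by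
      rw [h, Matrix.isUnit_iff_isUnit_det, Matrix.det_fromBlocks_zero₂₁]
      simp [Matrix.det_neg]
    exact Matrix.linearIndependent_rows_iff_isUnit.mpr hu

open scoped Classical in
/-- The rank function of `M₁` on sets of nodes. -/
noncomputable def rho₁ (o : EdgeOrientation G) (S : Finset (Fin N)) : ℕ :=
  (system o).rho₁ (S.map Function.Embedding.inl)

open scoped Classical in
/-- The rank function of `M₂` on sets of nodes. -/
noncomputable def rho₂ (o : EdgeOrientation G) (S : Finset (Fin N)) : ℕ :=
  (system o).rho₂ (matching o) (S.map Function.Embedding.inl)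

/-- The constraints `V \ S ∈ M₁* ∩ M₂*` and `|S| ≤ k`. -/
def Feasible (o : EdgeOrientation G) (k : ℕ) (S : Finset (Fin N)) : Prop :=
  RankDualIndep (rho₁ o) Sᶜ ∧ RankDualIndep (rho₂ o) Sᶜ ∧ S.card ≤ k

end Consensus

/-! ### Computation model

A random access machine with finitely many integer registers, integer arrays and real registers
per program. The graph is read through adjacency tests and the objective through a value oracle.
Every elementary instruction, test and oracle call takes one step. The largest integer in memory
grows by at most one per step, so unit cost is adequate. -/

namespace Machine

/-- The contents of the memory. -/
structure Store where
  int : ℕ → ℕ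
  arr : ℕ → ℕ → ℕ
  real : ℕ → ℝ

/-- Tests that control the flow of a program. -/
inductive Test
  | intLt (x y : ℕ)
  | intEq (x y : ℕ)
  | adj (x y : ℕ)
  | realLt (r q : ℕ)

/-- Elementary instructions. -/
inductive Instr
  | zero (x : ℕ)
  | succ (x : ℕ)
  | copy (x y : ℕ)
  | load (x a i : ℕ)
  | store (a i x : ℕ)
  | query (r a : ℕ)
  | realCopy (r q : ℕ)
  | realAdd (r p q : ℕ)
  | realSub (r p q : ℕ)

/-- Programs. -/
inductive Prog
  | instr (c : Instr)
  | seq (P Q : Prog)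
  | cond (b : Test) (P Q : Prog)
  | loop (b : Test) (P : Prog)

variable {N : ℕ}

/-- The set of nodes whose indicator function is array `a`. -/
def Store.set (s : Store) (N a : ℕ) : Finset (Fin N) :=
  Finset.univ.filter (fun v => s.arr a v.val ≠ 0)

/-- The truth value of a test. -/
def Test.holds (G : SimpleGraph (Fin N)) (s : Store) : Test → Prop
  | intLt x y => s.int x < s.int y
  | intEq x y => s.int x = s.int y
  | adj x y => ∃ u v : Fin N, u.val = s.int x ∧ v.val = s.int y ∧ G.Adj u v
  | realLt r q => s.real r < s.real q

/-- The effect of an instruction; `query r a` puts `f(S)` into the real register `r`, where `S` is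
the set held in array `a`. -/
def Instr.run (f : Finset (Fin N) → ℝ) (s : Store) : Instr → Store
  | zero x => { s with int := Function.update s.int x 0 }
  | succ x => { s with int := Function.update s.int x (s.int x + 1) }
  | copy x y => { s with int := Function.update s.int x (s.int y) }
  | load x a i => { s with int := Function.update s.int x (s.arr a (s.int i)) }
  | store a i x =>
      { s with arr := Function.update s.arr a (Function.update (s.arr a) (s.int i) (s.int x)) }
  | query r a => { s with real := Function.update s.real r (f (s.set N a)) }
  | realCopy r q => { s with real := Function.update s.real r (s.real q) }
  | realAdd r p q => { s with real := Function.update s.real r (s.real p + s.real q) }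
  | realSub r p q => { s with real := Function.update s.real r (s.real p - s.real q) }

/-- `Exec G f P s t s'`: started in `s`, program `P` halts in `s'` after exactly `t` steps. -/
inductive Exec (G : SimpleGraph (Fin N)) (f : Finset (Fin N) → ℝ) :
    Prog → Store → ℕ → Store → Prop
  | instr (c : Instr) (s : Store) : Exec G f (.instr c) s 1 (c.run f s)
  | seq {P Q : Prog} {s s₁ s₂ : Store} {t₁ t₂ : ℕ} : Exec G f P s t₁ s₁ → Exec G f Q s₁ t₂ s₂ →
      Exec G f (.seq P Q) s (t₁ + t₂) s₂
  | condTrue {b : Test} {P Q : Prog} {s s₁ : Store} {t : ℕ} : b.holds G s → Exec G f P s t s₁ →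
      Exec G f (.cond b P Q) s (t + 1) s₁
  | condFalse {b : Test} {P Q : Prog} {s s₁ : Store} {t : ℕ} : ¬ b.holds G s →
      Exec G f Q s t s₁ → Exec G f (.cond b P Q) s (t + 1) s₁
  | loopDone {b : Test} {P : Prog} {s : Store} : ¬ b.holds G s → Exec G f (.loop b P) s 1 s
  | loopStep {b : Test} {P : Prog} {s s₁ s₂ : Store} {t₁ t₂ : ℕ} : b.holds G s →
      Exec G f P s t₁ s₁ → Exec G f (.loop b P) s₁ t₂ s₂ →
      Exec G f (.loop b P) s (t₁ + t₂ + 1) s₂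

/-- The initial memory: integer registers `0` and `1` hold `N` and `k`, all else is zero. -/
def initial (N k : ℕ) : Store where
  int := fun x => if x = 0 then N else if x = 1 then k else 0
  arr := fun _ _ => 0
  real := fun _ => 0

/-- On the graph `G`, the bound `k` and the objective `f`, the program `P` halts within `T` steps,
and if the problem of maximizing `f` over the feasible sets has a feasible set at all, then the set
in array `0` is feasible and has at least `α` times the value of every feasible set. -/
def Approximates (P : Prog) (T : ℕ) (α : ℝ) (G : SimpleGraph (Fin N)) (k : ℕ)
    (f : Finset (Fin N) → ℝ) (feasible : Finset (Fin N) → Prop) : Prop :=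
  ∃ (t : ℕ) (s : Store), Exec G f P (initial N k) t s ∧ t ≤ T ∧
    ((∃ S, feasible S) → feasible (s.set N 0) ∧
      ∀ S, feasible S → α * f S ≤ f (s.set N 0))

end Machine

/-! ### Linear algebra of the incidence matrix -/

/-! Both matroid constraints reduce to connectivity. The columns of `K` have zero sum over every
connected component, and this is the only obstruction to full rank of the union: each component
costs one, and an input node in it removes the cost. Hence the first rank function counts the
components met by `S` (`Consensus.rho₁_eq`). In the auxiliary digraph each component with an edge
carries exactly one strongly connected component on cycles, and no path joins different components
of `G`, so the second rank function counts the components with an edge that `S` meets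
(`Consensus.systemRho₂_eq`). Thus `V \ S` is independent in the first dual iff `S` meets every
component, the second condition then follows, and feasibility means meeting every component with at
most `k` nodes (`Consensus.feasible_iff`).

The algorithm is greedy in two phases: pick the best node outside the components already met until
all are met, then the best remaining node until `k` nodes, or all nodes, are selected. For a block
`b` and a feasible `O`, write `κ = |O_b|`, `j = |S_b|`, and let `θ` be the largest marginal gain at
the final `S`. Separability makes a marginal gain depend only on the block of the new node, so each
pick in `b` closes at least a fraction `1/κ` of the gap to `O_b`, whatever happens in other blocks
(`GreedyDecay`). The key inequality is `(1 - 1/e)(f(O_b) - f(∅)) ≤ f(S_b) - f(∅) + θ(κ - j)`. For `j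
≥ κ`, the first `κ` picks give the factor `1 - 1/e` and each later pick gained at least `θ`
(`GreedyBalance`). For `j ≤ κ`, the share `1 - j/κ` of the gap is at most `θ(κ - j)`, and the share
`j/κ` is controlled by the decay and `x * exp (-x) ≤ 1/e`. Summing over the blocks leaves the error
`θ(|O| - |S|) ≤ 0` (`GreedyBalance.le_of_card_le`).

In (a) the blocks are the components; in (b) there is at most one component, so every objective is
separable. The same program serves both parts; loop invariants with step counts give a quartic
bound. -/

theorem Matrix.exists_linearIndepOn_row_card_eq_rank {m n : Type*} [Fintype m] [Fintype n]
    (A : Matrix m n ℝ) :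
    ∃ D : Finset m, LinearIndepOn ℝ A.row (D : Set m) ∧ D.card = A.rank := by
  classical
  obtain ⟨b, -, -, hspan, hb⟩ := exists_linearIndepOn_extension (K := ℝ) (v := A.row)
    (linearIndepOn_empty ℝ A.row) (Set.empty_subset Set.univ)
  refine ⟨b.toFinset, by simpa using hb, ?_⟩
  rw [Matrix.rank_eq_finrank_span_row]
  have h : Submodule.span ℝ (Set.range A.row) = Submodule.span ℝ (Set.range fun i : b => A.row i) := by
    apply le_antisymm
    · rw [Submodule.span_le]
      rintro _ ⟨i, rfl⟩
      rw [← Set.image_eq_range]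
      exact hspan ⟨i, trivial, rfl⟩
    · apply Submodule.span_mono
      rintro _ ⟨i, rfl⟩
      exact ⟨i, rfl⟩
  rw [h, finrank_span_eq_card hb, Set.toFinset_card]

namespace Consensus

open StructuredSystem

variable {N : ℕ} {G : SimpleGraph (Fin N)}

theorem adj_tail_head (o : EdgeOrientation G) (e : G.edgeSet) : G.Adj (o.tail e) (o.head e) := by
  have := e.2
  rwa [← o.ends e, SimpleGraph.mem_edgeSet] at this

theorem exists_tail_head_of_adj (o : EdgeOrientation G) {u v : Fin N} (h : G.Adj u v) :
    ∃ e : G.edgeSet, (o.tail e = u ∧ o.head e = v) ∨ (o.tail e = v ∧ o.head e = u) := by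
  refine ⟨⟨s(u, v), h⟩, ?_⟩
  simpa [Sym2.eq_iff] using o.ends ⟨s(u, v), h⟩

theorem connectedComponentMk_tail (o : EdgeOrientation G) (e : G.edgeSet) :
    G.connectedComponentMk (o.tail e) = G.connectedComponentMk (o.head e) :=
  SimpleGraph.ConnectedComponent.sound (adj_tail_head o e).reachable

theorem sum_mul_incidence (o : EdgeOrientation G) (e : G.edgeSet) (y : Fin N → ℝ) :
    ∑ i, y i * incidence o e i = y (o.tail e) - y (o.head e) := by
  simp [incidence, mul_sub, Finset.sum_sub_distrib]

/-- A vector annihilated by the incidence matrix is constant on connected components. -/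
theorem eq_of_incidence_mulVec_eq_zero (o : EdgeOrientation G) {y : Fin N → ℝ}
    (hy : ∀ e, y (o.tail e) = y (o.head e)) {u v : Fin N} (h : G.Reachable u v) : y u = y v := by
  obtain ⟨p⟩ := h
  induction p with
  | nil => rfl
  | cons hadj _ ih =>
    rw [← ih]
    obtain ⟨e, ⟨rfl, rfl⟩ | ⟨rfl, rfl⟩⟩ := exists_tail_head_of_adj o hadj
    · exact hy e
    · exact (hy e).symm

/-- By rank-nullity: a kernel vector is constant on components, hence determined by its values at
one representative of each. This inequality is all that the lower bound on the union rank needs. -/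
theorem le_rank_incidence (o : EdgeOrientation G) [Fintype G.edgeSet]
    [Fintype G.ConnectedComponent] :
    N ≤ (incidence o).rank + Fintype.card G.ConnectedComponent := by
  have hrn := LinearMap.finrank_range_add_finrank_ker (incidence o).mulVecLin
  rw [Module.finrank_fin_fun] at hrn
  have hker : Module.finrank ℝ (LinearMap.ker (incidence o).mulVecLin) ≤
      Fintype.card G.ConnectedComponent := by
    let φ : (Fin N → ℝ) →ₗ[ℝ] (G.ConnectedComponent → ℝ) := LinearMap.funLeft ℝ ℝ fun c => c.out
    have hφ : Function.Injective (φ.comp (LinearMap.ker (incidence o).mulVecLin).subtype) := by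
      rw [← LinearMap.ker_eq_bot, LinearMap.ker_eq_bot']
      rintro ⟨y, hy⟩ h0
      have hy' : ∀ e, y (o.tail e) = y (o.head e) := by
        intro e
        have := congrFun (LinearMap.mem_ker.1 hy) e
        simp only [Matrix.mulVecLin_apply, Matrix.mulVec, dotProduct, Pi.zero_apply] at this
        simp_rw [mul_comm (incidence o e _)] at this
        rw [sum_mul_incidence] at this
        linarith
      ext v
      have h1 := congrFun h0 (G.connectedComponentMk v)
      have h2 : G.Reachable (G.connectedComponentMk v).out v :=
        SimpleGraph.ConnectedComponent.exact (Quot.out_eq _)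
      exact (eq_of_incidence_mulVec_eq_zero o hy' h2).symm.trans h1
    have := LinearMap.finrank_le_finrank_of_injective hφ
    simpa using this
  have : Module.finrank ℝ (LinearMap.range (incidence o).mulVecLin) = (incidence o).rank := rfl
  omega

open scoped Classical in
/-- The sum of the entries of a column of `K` over a connected component vanishes. -/
theorem sum_incidence_component (o : EdgeOrientation G) (e : G.edgeSet)
    (c : G.ConnectedComponent) :
    ∑ i, (if G.connectedComponentMk i = c then (1 : ℝ) else 0) * incidence o e i = 0 := by
  rw [sum_mul_incidence, connectedComponentMk_tail, sub_self]

/-! ### The rank function of the first matroid -/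

theorem card_le_of_linearIndepOn_of_mem {γ W : Type*} [AddCommGroup W] [Module ℝ W]
    [FiniteDimensional ℝ W] {v : γ → W} {X : Finset γ} (p : Submodule ℝ W)
    (hX : LinearIndependent ℝ fun j : X => v j) (hp : ∀ j ∈ X, v j ∈ p) :
    X.card ≤ Module.finrank ℝ p := by
  have h : LinearIndependent ℝ fun j : X => (⟨v j, hp j j.2⟩ : p) :=
    LinearIndependent.of_comp p.subtype hX
  simpa using h.fintype_card_le_finrank

theorem linearIndependent_subset {γ W : Type*} [AddCommGroup W] [Module ℝ W]
    {v : γ → W} {X Y : Finset γ} (h : Y ⊆ X) (hX : LinearIndependent ℝ fun j : X => v j) :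
    LinearIndependent ℝ fun j : Y => v j :=
  hX.comp (fun j : Y => (⟨j, h j.2⟩ : X)) fun _ _ hab =>
    Subtype.ext (congrArg (fun x : X => x.1) hab)

theorem linearIndependent_of_eq_single {γ ι : Type*} [Finite ι] [DecidableEq ι]
    {v : γ → ι → ℝ} {X : Finset γ} (g : γ → ι) (hg : Set.InjOn g X)
    (hv : ∀ j ∈ X, v j = Pi.single (g j) 1) : LinearIndependent ℝ fun j : X => v j := by
  have := (Pi.basisFun ℝ ι).linearIndependent.comp (fun j : X => g j)
    fun a b hab => Subtype.ext (hg a.2 b.2 hab)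
  convert this using 2 with j
  simp [hv j j.2]

open scoped Classical in
-- The easy half of the matroid union formula: for any set `Y`, an independent set of the union has
-- at most `|Y|` elements in `Y` and at most the sum of the two ranks outside it. Here `Y` (called
-- `IU`) consists of the identity columns of the nodes in components that `S` misses.
theorem card_le_of_unionIndep (o : EdgeOrientation G) [Fintype G.edgeSet] (S : Finset (Fin N))
    {X : Finset ((Fin N ⊕ G.edgeSet) ⊕ ((Fin N ⊕ G.edgeSet) ⊕ (Fin N ⊕ G.edgeSet)))}
    (hX : UnionIndep (system o).FixedIndep ((system o).FreeIndep (S.map .inl)) X) :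
    X.card + Fintype.card G.ConnectedComponent ≤
      2 * (N + Fintype.card G.edgeSet) + (S.image G.connectedComponentMk).card := by
  obtain ⟨X₁, X₂, h₁, ⟨TA, TB, hTA, hTB, h₂⟩, rfl⟩ := hX
  let U : Finset (Fin N) := Finset.univ.filter fun i =>
    G.connectedComponentMk i ∉ S.image G.connectedComponentMk
  let IU : Finset ((Fin N ⊕ G.edgeSet) ⊕ ((Fin N ⊕ G.edgeSet) ⊕ (Fin N ⊕ G.edgeSet))) :=
    U.map ⟨fun i => Sum.inl (Sum.inl i), fun a b h => by simpa using h⟩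
  have hIU : IU.card = U.card := Finset.card_map _
  have hcard : (X₁ ∪ X₂).card ≤ (X₁ \ IU).card + (X₂ \ IU).card + IU.card := by
    refine (Finset.card_le_card (t := (X₁ \ IU ∪ X₂ \ IU) ∪ IU) ?_).trans
      ((Finset.card_union_le _ _).trans (Nat.add_le_add_right (Finset.card_union_le _ _) _))
    intro x hx
    by_cases hxU : x ∈ IU <;> simp_all
  -- the fixed part lies in the kernel of the component sums
  let Cu := {c : G.ConnectedComponent // c ∉ S.image G.connectedComponentMk}
  let φ : (Fin N ⊕ G.edgeSet → ℝ) →ₗ[ℝ] (Cu → ℝ) := LinearMap.pi fun c =>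
    ∑ i, (if G.connectedComponentMk i = c.1 then (1 : ℝ) else 0) • LinearMap.proj (Sum.inl i)
  have hφ_apply : ∀ y c, φ y c =
      ∑ i, (if G.connectedComponentMk i = c.1 then (1 : ℝ) else 0) * y (Sum.inl i) := by
    intro y c
    simp only [φ, LinearMap.pi_apply, LinearMap.sum_apply, LinearMap.smul_apply,
      LinearMap.proj_apply, smul_eq_mul]
  have hφ : Function.Surjective φ := by
    intro z
    -- A preimage of `z` puts the value `z c` on the representative of `c` and zero elsewhere.
    refine ⟨Sum.elim (fun i => ∑ c : Cu, if c.1.out = i then z c else 0) 0, ?_⟩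
    ext c
    rw [hφ_apply]
    simp only [Sum.elim_inl, Finset.mul_sum]
    rw [Finset.sum_comm]
    rw [Finset.sum_eq_single c]
    · have : G.connectedComponentMk c.1.out = c.1 := Quot.out_eq _
      simp [this]
    · intro b _ hb
      have : G.connectedComponentMk b.1.out = b.1 := Quot.out_eq _
      have hne : b.1 ≠ c.1 := fun h => hb (Subtype.ext h)
      simp [this, hne]
    · simp
  have hker : Module.finrank ℝ (LinearMap.ker φ) + Fintype.card Cu =
      N + Fintype.card G.edgeSet := by
    have h := LinearMap.finrank_range_add_finrank_ker φ
    rw [LinearMap.range_eq_top.2 hφ, finrank_top, Module.finrank_fintype_fun_eq_card,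
      Module.finrank_fintype_fun_eq_card] at h
    simp only [Fintype.card_sum, Fintype.card_fin] at h
    omega
  have hCu : Fintype.card Cu + (S.image G.connectedComponentMk).card =
      Fintype.card G.ConnectedComponent := by
    have h := Fintype.card_subtype_compl (fun c => c ∈ S.image G.connectedComponentMk)
    have h2 : Fintype.card {c // c ∈ S.image G.connectedComponentMk} =
      (S.image G.connectedComponentMk).card := Fintype.card_coe _
    have h3 := Finset.card_le_univ (S.image G.connectedComponentMk)
    rw [h2] at h
    change Fintype.card Cu = _ at h
    omega
  have hX₁ : (X₁ \ IU).card ≤ Module.finrank ℝ (LinearMap.ker φ) := by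
    refine card_le_of_linearIndepOn_of_mem _
      (linearIndependent_subset Finset.sdiff_subset h₁) fun j hj => ?_
    rw [LinearMap.mem_ker]
    ext c
    rw [hφ_apply]
    obtain ⟨hj1, hj2⟩ := Finset.mem_sdiff.1 hj
    rcases j with (i | e) | (i | e) | (i | e)
    · have hi : G.connectedComponentMk i ≠ c.1 := by
        rintro h
        refine hj2 (Finset.mem_map.2 ⟨i, ?_, rfl⟩)
        simp only [U, Finset.mem_filter, Finset.mem_univ, true_and, h]
        exact c.2
      simp only [augmented, Matrix.col_apply, Matrix.fromCols_apply_inl, Matrix.one_apply,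
        Sum.inl.injEq, Pi.zero_apply]
      refine Finset.sum_eq_zero fun x _ => ?_
      by_cases hx : x = i
      · subst hx; simp [hi]
      · simp [hx]
    · simp [augmented]
    · simp [augmented, system]
    · simpa [augmented, system] using sum_incidence_component o e c.1
    · simp [augmented]
    · simp [augmented]
  -- the free part lives on the rows outside `U`
  let ψ : (Fin N ⊕ G.edgeSet → ℝ) →ₗ[ℝ] (U → ℝ) := LinearMap.funLeft ℝ ℝ fun i => Sum.inl i.1
  have hψ : Function.Surjective ψ :=
    LinearMap.funLeft_surjective_of_injective _ _ _ fun _ _ h => Subtype.ext (Sum.inl_injective h)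
  have hkerψ : Module.finrank ℝ (LinearMap.ker ψ) + U.card = N + Fintype.card G.edgeSet := by
    have h := LinearMap.finrank_range_add_finrank_ker ψ
    rw [LinearMap.range_eq_top.2 hψ, finrank_top, Module.finrank_fintype_fun_eq_card,
      Module.finrank_fintype_fun_eq_card] at h
    simp only [Fintype.card_sum, Fintype.card_fin, Fintype.card_coe] at h
    omega
  have hX₂ : (X₂ \ IU).card ≤ Module.finrank ℝ (LinearMap.ker ψ) := by
    refine card_le_of_linearIndepOn_of_mem _
      (linearIndependent_subset Finset.sdiff_subset h₂) fun j hj => ?_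
    rw [LinearMap.mem_ker]
    ext ⟨u, hu⟩
    change augmented TA TB (Sum.inl u) j = 0
    obtain ⟨hj1, hj2⟩ := Finset.mem_sdiff.1 hj
    rcases j with j | j | j
    · have : Sum.inl u ≠ j := by
        rintro rfl
        exact hj2 (Finset.mem_map.2 ⟨u, hu, rfl⟩)
      simp [augmented, this]
    · exact hTA _ _ (by simp [system])
    · refine hTB _ _ ?_
      rintro ⟨-, h⟩
      have huS : u ∈ S := by simpa using h
      exact (Finset.mem_filter.1 hu).2 (Finset.mem_image_of_mem _ huS)
  omega

/-- The columns decouple into node rows and edge rows. On the edge rows in `D` only the columns from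
`R` survive, so their coefficients vanish, and then those of `D'`. On the node rows, summing over a
component kills the columns of `K` and isolates the single member of `H` there; the rest is a
relation between independent rows of the incidence matrix. -/
theorem fixedIndep_disjSum (o : EdgeOrientation G) [Fintype G.edgeSet]
    {H R : Finset (Fin N)} {D D' : Finset G.edgeSet}
    (hH : Set.InjOn G.connectedComponentMk H)
    (hD : LinearIndepOn ℝ (incidence o).row (D : Set G.edgeSet))
    (hR : ∀ a : Fin N → ℝ, (∀ e ∈ D, ∑ i ∈ R, a i * incidence o e i = 0) → ∀ i ∈ R, a i = 0)
    (hDD' : Disjoint D D') :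
    (system o).FixedIndep ((H.disjSum D').disjSum ((R.disjSum D).disjSum ∅)) := by
  classical
  change LinearIndepOn ℝ (augmented (system o).QA 0).col
    ((H.disjSum D').disjSum ((R.disjSum D).disjSum ∅) :
      Finset ((Fin N ⊕ G.edgeSet) ⊕ ((Fin N ⊕ G.edgeSet) ⊕ (Fin N ⊕ G.edgeSet))))
  rw [linearIndepOn_finset_iff]
  intro g hg
  simp only [Finset.sum_disjSum, Finset.sum_empty, add_zero] at hg
  have hnode : ∀ v : Fin N, (if v ∈ H then g (.inl (.inl v)) else 0) +
      ∑ e ∈ D, g (.inr (.inl (.inr e))) * incidence o e v = 0 := by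
    intro v
    have := congrFun hg (Sum.inl v)
    simpa [augmented, system, Matrix.one_apply, Finset.sum_apply] using this
  have hedge : ∀ e : G.edgeSet, (if e ∈ D' then g (.inl (.inr e)) else 0) +
      ∑ i ∈ R, g (.inr (.inl (.inl i))) * incidence o e i = 0 := by
    intro e
    have := congrFun hg (Sum.inr e)
    simpa [augmented, system, Matrix.one_apply, Finset.sum_apply] using this
  have hgR : ∀ i ∈ R, g (.inr (.inl (.inl i))) = 0 := by
    refine hR _ fun e he => ?_
    have := hedge e
    rwa [if_neg (Finset.disjoint_left.1 hDD' he), zero_add] at this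
  have hgD' : ∀ e ∈ D', g (.inl (.inr e)) = 0 := by
    intro e he
    have := hedge e
    rwa [if_pos he, Finset.sum_eq_zero (fun i hi => by rw [hgR i hi, zero_mul]), add_zero] at this
  have hgH : ∀ h ∈ H, g (.inl (.inl h)) = 0 := by
    intro h hh
    have hsum : ∑ v, (if G.connectedComponentMk v = G.connectedComponentMk h then (1 : ℝ) else 0) *
        ((if v ∈ H then g (.inl (.inl v)) else 0) +
          ∑ e ∈ D, g (.inr (.inl (.inr e))) * incidence o e v) = 0 :=
      Finset.sum_eq_zero fun v _ => by rw [hnode v, mul_zero]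
    simp only [mul_add, Finset.sum_add_distrib, Finset.mul_sum] at hsum
    rw [Finset.sum_comm (t := D), Finset.sum_eq_single h, Finset.sum_eq_zero (s := D)] at hsum
    · simpa [hh] using hsum
    · intro e _
      simp_rw [mul_left_comm _ (g (.inr (.inl (.inr e))))]
      rw [← Finset.mul_sum, sum_incidence_component, mul_zero]
    · intro v _ hv
      by_cases hvH : v ∈ H
      · rw [if_neg (fun hc => hv (hH hvH hh hc)), zero_mul]
      · rw [if_neg hvH, mul_zero]
    · simp
  have hgD : ∀ e ∈ D, g (.inr (.inl (.inr e))) = 0 := by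
    refine linearIndepOn_finset_iff.1 hD (fun e => g (.inr (.inl (.inr e)))) ?_
    ext v
    have := hnode v
    have h0 : (if v ∈ H then g (.inl (.inl v)) else 0) = 0 := by
      split_ifs with hv
      · exact hgH v hv
      · rfl
    rw [h0, zero_add] at this
    simpa [Finset.sum_apply] using this
  rintro ((i | e) | (i | e) | (i | e)) hi
  · exact hgH i (by simpa using hi)
  · exact hgD' e (by simpa using hi)
  · exact hgR i (by simpa using hi)
  · exact hgD e (by simpa using hi)
  · simp at hi
  · simp at hi

/-- With all free parameters set to one, the chosen columns are distinct unit vectors. -/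
theorem freeIndep_disjSum (o : EdgeOrientation G) [Fintype G.edgeSet]
    {S H H' : Finset (Fin N)} {D D' : Finset G.edgeSet} (hHS : H ⊆ S) (hH : Disjoint H H')
    (hD : Disjoint D D') :
    (system o).FreeIndep (S.map .inl)
      ((H'.disjSum D).disjSum ((Finset.disjSum ∅ D').disjSum (H.disjSum ∅))) := by
  classical
  refine ⟨Matrix.fromBlocks 0 0 0 1,
    Matrix.of fun i j => if i = j ∧ i ∈ S.map .inl then 1 else 0, ?_, ?_, ?_⟩
  · rintro (i | e) (j | e') h
    · rfl
    · rfl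
    · rfl
    · simp only [system, not_exists, not_and] at h
      simp only [Matrix.fromBlocks_apply₂₂]
      exact Matrix.one_apply_ne fun hee => h e rfl (by rw [hee])
  · intro i j h
    rw [Matrix.of_apply, if_neg h]
  · refine linearIndependent_of_eq_single (Sum.elim id (Sum.elim id id)) ?_ ?_
    · have h1 := Finset.disjoint_left.1 hH
      have h2 := Finset.disjoint_left.1 hD
      rintro ((i | e) | (i | e) | (i | e)) hi ((j | e') | (j | e') | (j | e')) hj hij <;>
        simp at hi hj hij ⊢ <;>
        first
          | exact hij
          | exact h1 hj (hij ▸ hi)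
          | exact h1 hi (hij ▸ hj)
          | exact h2 hj (hij ▸ hi)
          | exact h2 hi (hij ▸ hj)
    · rintro ((i | e) | (i | e) | (i | e)) hi <;> simp at hi <;> ext (a | a) <;>
        simp [augmented, Matrix.one_apply, Pi.single_apply]
      exact if_congr ⟨And.left, fun h => ⟨h, h ▸ hHS hi⟩⟩ rfl rfl

open scoped Classical in
-- For the lower bound, take a row basis `D` of the incidence matrix, a column basis `R` of the rows
-- in `D`, and one node of `S` per component it meets, forming `H`. The fixed part takes over the
-- identity columns at `H` and `Dᶜ`, which the free part replaces by input and `W` columns.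
theorem indepRank_unionIndep (o : EdgeOrientation G) [Fintype G.edgeSet] (S : Finset (Fin N)) :
    indepRank (UnionIndep (system o).FixedIndep ((system o).FreeIndep (S.map .inl))) +
        Fintype.card G.ConnectedComponent =
      2 * (N + Fintype.card G.edgeSet) + (S.image G.connectedComponentMk).card := by
  apply le_antisymm
  · obtain ⟨X, hX, hXr⟩ := Finset.exists_mem_eq_sup (Finset.univ.filter
      (UnionIndep (system o).FixedIndep ((system o).FreeIndep (S.map .inl))))
      ⟨∅, by
        rw [Finset.mem_filter]
        refine ⟨Finset.mem_univ _, ∅, ∅, linearIndependent_empty_type, ?_, rfl⟩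
        exact ⟨0, 0, fun _ _ _ => rfl, fun _ _ _ => rfl, linearIndependent_empty_type⟩⟩
      Finset.card
    have h := card_le_of_unionIndep o S (Finset.mem_filter.1 hX).2
    unfold indepRank
    rw [hXr]
    exact h
  · obtain ⟨D, hD, hDcard⟩ := (incidence o).exists_linearIndepOn_row_card_eq_rank
    obtain ⟨R, hR, hRcard⟩ := ((incidence o).submatrix (fun e : D => e.1)
      id).transpose.exists_linearIndepOn_row_card_eq_rank
    have hDrank : ((incidence o).submatrix (fun e : D => e.1) id).rank = D.card := by
      have h : LinearIndependent ℝ ((incidence o).submatrix (fun e : D => e.1) id).row := hD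
      rw [h.rank_matrix, Fintype.card_coe]
    rw [Matrix.rank_transpose, hDrank] at hRcard
    obtain ⟨H, hHS, hHinj, hHim⟩ := Finset.exists_subset_injOn_image_eq_of_surjOn
      (s := (S : Set (Fin N))) (S.image G.connectedComponentMk)
      (f := G.connectedComponentMk) (by simp [Set.SurjOn])
    rw [Finset.coe_subset] at hHS
    have hHcard : H.card = (S.image G.connectedComponentMk).card := by
      rw [← hHim, Finset.card_image_of_injOn hHinj]
    have hfix := fixedIndep_disjSum o (R := R) (D' := Dᶜ) hHinj hD (by
      intro a ha
      refine linearIndepOn_finset_iff.1 hR a ?_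
      ext e
      simpa [Finset.sum_apply] using ha e e.2) disjoint_compl_right
    have hfree := freeIndep_disjSum o hHS (disjoint_compl_right (a := H))
      (disjoint_compl_right (a := D))
    have hle := Finset.le_sup (f := Finset.card) (s := Finset.univ.filter
      (UnionIndep (system o).FixedIndep ((system o).FreeIndep (S.map .inl))))
      (Finset.mem_filter.2 ⟨Finset.mem_univ _, _, _, hfix, hfree, rfl⟩)
    -- The union has all `N + M` identity columns, `|R| ≥ N - #components` node columns, all `M`
    -- edge columns and `|H|` input columns, which is the required size.
    have hset : (H.disjSum Dᶜ).disjSum ((R.disjSum D).disjSum (∅ : Finset (Fin N ⊕ G.edgeSet))) ∪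
        (Hᶜ.disjSum D).disjSum ((Finset.disjSum ∅ Dᶜ).disjSum (H.disjSum ∅)) =
        Finset.univ.disjSum ((R.disjSum Finset.univ).disjSum (H.disjSum ∅)) := by
      ext ((i | e) | (i | e) | (i | e)) <;> simp [em, or_comm]
    rw [hset] at hle
    simp only [Finset.card_disjSum, Finset.card_univ, Fintype.card_sum, Fintype.card_fin,
      Finset.card_empty] at hle
    have := le_rank_incidence o
    unfold indepRank
    omega

open scoped Classical in
theorem rho₁_eq (o : EdgeOrientation G) (S : Finset (Fin N)) :
    rho₁ o S = (S.image G.connectedComponentMk).card := by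
  have h := indepRank_unionIndep o S
  have h0 := indepRank_unionIndep o ∅
  rw [Finset.image_empty, Finset.card_empty, Finset.map_empty] at h0
  unfold rho₁ StructuredSystem.rho₁
  omega

end Consensus

/-! ### Partition matroids -/

open scoped Classical in
/-- In the matroid whose rank counts the blocks met by a set, the complement of a set that meets
every block is independent in the dual. -/
theorem rankDualIndep_compl_of_forall {V β : Type*} [Fintype V] {p : V → Prop} {c : V → β}
    {ρ : Finset V → ℕ} (hρ : ∀ S, ρ S = ((S.filter p).image c).card) {S : Finset V}
    (hS : ∀ v, p v → ∃ s ∈ S, p s ∧ c s = c v) : RankDualIndep ρ Sᶜ := by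
  obtain ⟨B, hBS, hBinj, hBim⟩ := Finset.exists_subset_injOn_image_eq_of_surjOn
    (s := (S.filter p : Set V)) ((S.filter p).image c) (f := c)
    (by rw [Finset.coe_image]; exact Set.surjOn_image _ _)
  rw [Finset.coe_subset] at hBS
  have hBp : B.filter p = B := Finset.filter_true_of_mem fun v hv => (Finset.mem_filter.1 (hBS hv)).2
  refine ⟨B, ⟨?_, ?_⟩, ?_⟩
  · rw [RankIndep, hρ, hBp, Finset.card_image_of_injOn hBinj]
  · intro B' hB' hBB' v hv
    rw [RankIndep, hρ] at hB'
    have h1 : (B'.filter p).card = B'.card :=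
      le_antisymm (Finset.card_filter_le _ _) (hB' ▸ Finset.card_image_le)
    have h2 := Finset.card_filter_eq_iff.1 h1
    have h3 : B'.filter p = B' := Finset.filter_true_of_mem h2
    rw [h3] at hB'
    have hinj := Finset.card_image_iff.1 hB'
    obtain ⟨s, hs, hps, hcs⟩ := hS v (h2 v hv)
    have : c v ∈ B.image c := by
      rw [hBim, ← hcs]
      exact Finset.mem_image_of_mem _ (Finset.mem_filter.2 ⟨hs, hps⟩)
    obtain ⟨b, hb, hbv⟩ := Finset.mem_image.1 this
    rwa [← hinj (hBB' hb) hv hbv]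
  · exact Finset.compl_subset_compl.2 (hBS.trans (Finset.filter_subset _ _))

open scoped Classical in
-- Dual independence of the complement puts a basis inside `S`. A basis meets every block, since a
-- node of a missed block could be added to it.
theorem exists_mem_of_rankDualIndep_compl {V β : Type*} [Fintype V] {c : V → β}
    {ρ : Finset V → ℕ} (hρ : ∀ S, ρ S = (S.image c).card) {S : Finset V}
    (hS : RankDualIndep ρ Sᶜ) (v : V) : ∃ s ∈ S, c s = c v := by
  obtain ⟨B, hB, hBS⟩ := hS
  have hBS' : B ⊆ S := Finset.compl_subset_compl.1 hBS
  by_contra! hv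
  have hvB : c v ∉ B.image c := by
    intro h
    obtain ⟨b, hb, hbv⟩ := Finset.mem_image.1 h
    exact hv b (hBS' hb) hbv
  have hvB' : v ∉ B := fun h => hvB (Finset.mem_image_of_mem _ h)
  have hind : RankIndep ρ (insert v B) := by
    have := hB.prop
    rw [RankIndep, hρ] at this ⊢
    rw [Finset.image_insert, Finset.card_insert_of_notMem hvB, Finset.card_insert_of_notMem hvB',
      this]
  exact hvB' (hB.le_of_ge hind (Finset.subset_insert _ _) (Finset.mem_insert_self _ _))

namespace Consensus

open StructuredSystem

variable {N : ℕ} {G : SimpleGraph (Fin N)}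

/-! ### The auxiliary graph -/

/-- Explicit because the block matrix `Ω_J` is an involution. -/
theorem OmegaTilde_eq (o : EdgeOrientation G) [Fintype G.edgeSet] :
    (system o).OmegaTilde (matching o) = Matrix.fromRows
      (Matrix.fromBlocks 1 0 (-incidence o) (incidence o * (incidence o).transpose))
      (Matrix.fromBlocks (-1) (incidence o).transpose 0 1) := by
  have hJ : (system o).Omega.submatrix (matching o).m id =
      Matrix.fromBlocks (-1) (incidence o).transpose 0 1 := by
    ext a b
    rcases a with i | e <;> rcases b with j | e' <;>
      simp [Omega, system, matching, Matrix.one_apply]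
  have hinv : ((system o).Omega.submatrix (matching o).m id)⁻¹ =
      Matrix.fromBlocks (-1) (incidence o).transpose 0 1 := by
    apply Matrix.inv_eq_right_inv
    rw [hJ, Matrix.fromBlocks_multiply]
    simp
  have hΩ : (system o).Omega = Matrix.fromRows
      (Matrix.fromBlocks (-1) (incidence o).transpose (incidence o) 0) 1 := by
    ext (a | a) b
    · rcases a with i | e <;> rcases b with j | e' <;> simp [Omega, system]
    · simp [Omega]
  rw [OmegaTilde, hinv, hΩ, Matrix.fromRows_mul, Matrix.one_mul, Matrix.fromBlocks_multiply]
  simp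

theorem incidence_ne_zero_iff (o : EdgeOrientation G) (e : G.edgeSet) (i : Fin N) :
    incidence o e i ≠ 0 ↔ i = o.tail e ∨ i = o.head e := by
  have := (adj_tail_head o e).ne
  by_cases h1 : i = o.tail e <;> by_cases h2 : i = o.head e <;> simp_all [incidence]

/-- An entry of `K_I K` is nonzero iff its two edges share a node. -/
theorem incidence_mul_transpose_ne_zero_iff (o : EdgeOrientation G) (e e' : G.edgeSet) :
    (incidence o * (incidence o).transpose) e e' ≠ 0 ↔
      ∃ i, (i = o.tail e ∨ i = o.head e) ∧ (i = o.tail e' ∨ i = o.head e') := by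
  have hne := (adj_tail_head o e).ne
  have hne' := (adj_tail_head o e').ne
  have hval : (incidence o * (incidence o).transpose) e e' =
      incidence o e (o.tail e') - incidence o e (o.head e') := by
    rw [Matrix.mul_apply]
    simpa using sum_mul_incidence o e' (incidence o e)
  rw [hval]
  constructor
  · intro h
    by_contra! hc
    apply h
    have h1 : incidence o e (o.tail e') = 0 := by
      by_contra h0
      have := (incidence_ne_zero_iff o e _).1 h0
      exact (hc _ this).1 rfl
    have h2 : incidence o e (o.head e') = 0 := by
      by_contra h0
      have := (incidence_ne_zero_iff o e _).1 h0
      exact (hc _ this).2 rfl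
    rw [h1, h2, sub_zero]
  · have hee : (o.tail e' = o.tail e ∧ o.head e' = o.head e) ∨
        (o.tail e' = o.head e ∧ o.head e' = o.tail e) ∨
        ¬ ((o.tail e' = o.tail e ∨ o.tail e' = o.head e) ∧
          (o.head e' = o.tail e ∨ o.head e' = o.head e)) := by
      by_contra! h
      obtain ⟨h1, h2, h3, h4⟩ := h
      rcases h3 with h3 | h3 <;> rcases h4 with h4 | h4
      · exact hne' (h3.trans h4.symm)
      · exact h1 h3 h4
      · exact h2 h3 h4
      · exact hne' (h3.trans h4.symm)
    rintro ⟨i, hi, hi'⟩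
    simp only [incidence]
    grind

theorem connectedComponentMk_of_mem (o : EdgeOrientation G) {e : G.edgeSet} {i : Fin N}
    (h : i = o.tail e ∨ i = o.head e) :
    G.connectedComponentMk i = G.connectedComponentMk (o.tail e) := by
  rcases h with rfl | rfl
  · rfl
  · exact (connectedComponentMk_tail o e).symm

section AuxGraph

variable (o : EdgeOrientation G) [Fintype G.edgeSet]

/-- The connected component of the node or edge to which a vertex of the auxiliary graph
belongs. -/
def auxLabel : AuxVertex (Fin N ⊕ G.edgeSet) → G.ConnectedComponent :=
  let l : Fin N ⊕ G.edgeSet → G.ConnectedComponent :=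
    Sum.elim G.connectedComponentMk fun e => G.connectedComponentMk (o.tail e)
  Sum.elim (Sum.elim l l) (Sum.elim l l)

/-- The nonzero entries of `Ω̃` outside the rows in `J` come from `K`, `K_I`, `K_I K` and a diagonal
block, which only couple nodes and edges of one component. -/
theorem auxLabel_eq_of_auxEdge {u v : AuxVertex (Fin N ⊕ G.edgeSet)}
    (h : (system o).AuxEdge (matching o) u v) : auxLabel o u = auxLabel o v := by
  cases h with
  | freeUnmatched i j h _ =>
    obtain ⟨e, rfl, rfl⟩ | h := h
    · rfl
    · exact h.elim
  | freeMatched i j h _ =>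
    obtain ⟨e, rfl, rfl⟩ | h := h
    · rfl
    · exact h.elim
  | copyUnmatched i => rfl
  | copyMatched i => rfl
  | fixed v i hv hvi =>
    rw [OmegaTilde_eq] at hvi
    rcases v with (v | e) | (v | e) <;> rcases i with i | e'
    · exact (hv ⟨Sum.inl v, rfl⟩).elim
    · exact (hv ⟨Sum.inl v, rfl⟩).elim
    · have : incidence o e i ≠ 0 := by simpa using hvi
      exact (connectedComponentMk_of_mem o ((incidence_ne_zero_iff o e i).1 this)).symm
    · have : (incidence o * (incidence o).transpose) e e' ≠ 0 := by simpa using hvi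
      obtain ⟨i, hi, hi'⟩ := (incidence_mul_transpose_ne_zero_iff o e e').1 this
      exact (connectedComponentMk_of_mem o hi).symm.trans (connectedComponentMk_of_mem o hi')
    · have : v = i := by
        by_contra h
        simp [h] at hvi
      rw [this]
      rfl
    · have : incidence o e' v ≠ 0 := by simpa using hvi
      exact connectedComponentMk_of_mem o ((incidence_ne_zero_iff o e' v).1 this)
    · exact (hv ⟨Sum.inr e, rfl⟩).elim
    · exact (hv ⟨Sum.inr e, rfl⟩).elim

theorem auxLabel_eq_of_auxReach {u v : AuxVertex (Fin N ⊕ G.edgeSet)}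
    (h : (system o).AuxReach (matching o) u v) : auxLabel o u = auxLabel o v := by
  induction h with
  | refl => rfl
  | tail _ h ih => exact ih.trans (auxLabel_eq_of_auxEdge o h)

theorem auxEdge_xQ_wT (e : G.edgeSet) :
    (system o).AuxEdge (matching o) (vQ (.inr (.inr e))) (wT (.inr e)) :=
  .freeMatched _ _ (Or.inl ⟨e, rfl, rfl⟩) rfl

theorem auxEdge_wT_wQ (e : G.edgeSet) :
    (system o).AuxEdge (matching o) (wT (.inr e)) (vQ (.inl (.inr e))) :=
  .copyUnmatched _ (by simp [matching])

theorem auxEdge_wQ_xQ {e e' : G.edgeSet} {i : Fin N} (hi : i = o.tail e ∨ i = o.head e)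
    (hi' : i = o.tail e' ∨ i = o.head e') :
    (system o).AuxEdge (matching o) (vQ (.inl (.inr e))) (vQ (.inr (.inr e'))) := by
  refine .fixed (Sum.inl (Sum.inr e)) (Sum.inr e') ?_ ?_
  · rintro ⟨a | a, h⟩ <;> simp [matching] at h
  · rw [OmegaTilde_eq]
    simpa using (incidence_mul_transpose_ne_zero_iff o e e').2 ⟨i, hi, hi'⟩

theorem auxReach_wQ_wT {e : G.edgeSet} {i : Fin N} (hi : i = o.tail e ∨ i = o.head e) :
    (system o).AuxReach (matching o) (vQ (.inl (.inr e))) (wT (.inl i)) := by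
  have h : (system o).AuxEdge (matching o) (vQ (.inl (.inr e))) (vQ (.inl (.inl i))) := by
    refine .fixed (Sum.inl (Sum.inr e)) (Sum.inl i) ?_ ?_
    · rintro ⟨a | a, h⟩ <;> simp [matching] at h
    · rw [OmegaTilde_eq]
      simpa using (incidence_ne_zero_iff o e i).2 hi
  exact (Relation.ReflTransGen.single h).tail (.copyMatched _ rfl)

/-- The path is `wₑ^Q → xₑ'^Q → wₑ'^T → wₑ'^Q`. The case `e = e'` shows that every `wₑ^Q` lies on a
cycle. -/
theorem transGen_wQ_wQ {e e' : G.edgeSet} {i : Fin N} (hi : i = o.tail e ∨ i = o.head e)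
    (hi' : i = o.tail e' ∨ i = o.head e') :
    Relation.TransGen ((system o).AuxEdge (matching o)) (vQ (.inl (.inr e)))
      (vQ (.inl (.inr e'))) :=
  ((Relation.TransGen.single (auxEdge_wQ_xQ o hi hi')).tail (auxEdge_xQ_wT o e')).tail
    (auxEdge_wT_wQ o e')

theorem auxReach_wQ_wQ_of_reachable {u v : Fin N} (h : G.Reachable u v) {e e' : G.edgeSet}
    (hu : u = o.tail e ∨ u = o.head e) (hv : v = o.tail e' ∨ v = o.head e') :
    (system o).AuxReach (matching o) (vQ (.inl (.inr e))) (vQ (.inl (.inr e'))) := by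
  obtain ⟨p⟩ := h
  induction p generalizing e with
  | nil => exact (transGen_wQ_wQ o hu hv).to_reflTransGen
  | cons hadj _ ih =>
    obtain ⟨e₀, he₀⟩ := exists_tail_head_of_adj o hadj
    refine (transGen_wQ_wQ o hu (e' := e₀) ?_).to_reflTransGen.trans (ih (e := e₀) ?_ hv)
    · rcases he₀ with h | h <;> simp [h]
    · rcases he₀ with h | h <;> simp [h]

/-- A vertex on a cycle is mutually reachable with `wₑ^Q` for some edge `e`. -/
theorem exists_wQ_of_auxOnCycle {v : AuxVertex (Fin N ⊕ G.edgeSet)}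
    (h : (system o).AuxOnCycle (matching o) v) :
    ∃ e, (system o).AuxReach (matching o) v (vQ (.inl (.inr e))) ∧
      (system o).AuxReach (matching o) (vQ (.inl (.inr e))) v := by
  have hwT : ∀ i : Fin N, ∀ w, ¬ (system o).AuxEdge (matching o) (wT (.inl i)) w := by
    intro i w hw
    cases hw with
    | freeUnmatched _ _ h =>
      obtain ⟨e, h, -⟩ | h := h
      · cases h
      · exact h
    | copyUnmatched _ h => exact h rfl
  -- Node vertices and the copies `x^T` are on no cycle: `wᵢ^T` and all `x^T` have no outgoing edge,
  -- `wᵢ^Q` leads only to `wᵢ^T`, and `xᵢ^Q` has no incoming edge.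
  rcases v with (v | v) | ((i | e) | (i | e))
  · rcases v with i | e
    · obtain ⟨w, hw, -⟩ := Relation.TransGen.head'_iff.1 h
      exact (hwT i w hw).elim
    · have := auxEdge_xQ_wT o e
      have h2 := auxEdge_wQ_xQ o (e := e) (e' := e) (Or.inl rfl) (Or.inl rfl)
      exact ⟨e, .single (auxEdge_wT_wQ o e), (Relation.ReflTransGen.single h2).tail this⟩
  · obtain ⟨w, hw, -⟩ := Relation.TransGen.head'_iff.1 h
    cases hw
  · obtain ⟨w, hw, hreach⟩ := Relation.TransGen.head'_iff.1 h
    have hw' : w = wT (.inl i) := by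
      cases hw with
      | copyMatched => rfl
      | fixed _ _ hv => exact (hv ⟨Sum.inl i, rfl⟩).elim
    subst hw'
    rcases Relation.ReflTransGen.cases_head hreach with h | ⟨w, hw, -⟩
    · cases h
    · exact (hwT i w hw).elim
  · exact ⟨e, .refl, .refl⟩
  · obtain ⟨w, -, hw⟩ := Relation.TransGen.tail'_iff.1 h
    exfalso
    generalize hz : (Sum.inr (Sum.inr (Sum.inl i)) : AuxVertex (Fin N ⊕ G.edgeSet)) = z at hw
    cases hw with
    | freeUnmatched _ _ h =>
      obtain ⟨e, -, rfl⟩ | h := h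
      · simp at hz
      · exact h
    | freeMatched => cases hz
    | copyUnmatched => cases hz
    | copyMatched => cases hz
    | fixed v j => rcases j with j | j <;> simp [matching] at hz
  · exact ⟨e, .tail (.single (auxEdge_xQ_wT o e)) (auxEdge_wT_wQ o e),
      .single (auxEdge_wQ_xQ o (e := e) (e' := e) (Or.inl rfl) (Or.inl rfl))⟩

/-- Vertices on cycles are mutually reachable as soon as they belong to the same component. -/
theorem auxReach_of_auxLabel_eq {u v : AuxVertex (Fin N ⊕ G.edgeSet)}
    (hu : (system o).AuxOnCycle (matching o) u) (hv : (system o).AuxOnCycle (matching o) v)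
    (h : auxLabel o u = auxLabel o v) : (system o).AuxReach (matching o) u v := by
  obtain ⟨e, hue, -⟩ := exists_wQ_of_auxOnCycle o hu
  obtain ⟨e', -, hve⟩ := exists_wQ_of_auxOnCycle o hv
  have hl : G.connectedComponentMk (o.tail e) = G.connectedComponentMk (o.tail e') :=
    (auxLabel_eq_of_auxReach o hue).symm.trans (h.trans (auxLabel_eq_of_auxReach o hve).symm)
  exact (hue.trans (auxReach_wQ_wQ_of_reachable o (SimpleGraph.ConnectedComponent.exact hl)
    (Or.inl rfl) (Or.inl rfl))).trans hve

theorem auxClass_eq {v : AuxVertex (Fin N ⊕ G.edgeSet)}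
    (hv : (system o).AuxOnCycle (matching o) v) :
    (system o).auxClass (matching o) v =
      {u | (system o).AuxOnCycle (matching o) u ∧ auxLabel o u = auxLabel o v} := by
  ext u
  constructor
  · rintro ⟨huv, hvu⟩
    exact ⟨Relation.TransGen.trans_right huv (Relation.TransGen.trans_left hv hvu),
      auxLabel_eq_of_auxReach o huv⟩
  · rintro ⟨hu, h⟩
    exact ⟨auxReach_of_auxLabel_eq o hu hv h, auxReach_of_auxLabel_eq o hv hu h.symm⟩

open scoped Classical in
-- A class of vertices on cycles is determined by its component, which must contain an edge. All
-- such classes are extremal because paths preserve the component, and a node `i` with an incident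
-- edge `e` is reached from `wₑ^Q`. Isolated nodes are loops of the second matroid.
theorem systemRho₂_eq (S : Finset (Fin N)) :
    (system o).rho₂ (matching o) (S.map .inl) =
      ((S.filter fun i => ∃ j, G.Adj i j).image fun i =>
        {u | (system o).AuxOnCycle (matching o) u ∧
          auxLabel o u = G.connectedComponentMk i}).card := by
  rw [StructuredSystem.rho₂, ← Set.ncard_coe_finset]
  congr 1
  ext C
  simp only [Finset.coe_image, Finset.coe_filter, Set.mem_image, Set.mem_ofPred_eq]
  constructor
  · rintro ⟨⟨v, hv, rfl, -⟩, w, hw, s, hs, hreach⟩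
    obtain ⟨i, hi, rfl⟩ := Finset.mem_map.1 hs
    have hlw := auxLabel_eq_of_auxReach o hreach
    have hwv := auxLabel_eq_of_auxReach o hw.1
    have hli : auxLabel o v = G.connectedComponentMk i := hwv.symm.trans hlw
    refine ⟨i, ⟨hi, ?_⟩, by rw [auxClass_eq o hv, hli]⟩
    obtain ⟨e, hve, -⟩ := exists_wQ_of_auxOnCycle o hv
    have he : G.connectedComponentMk (o.tail e) = G.connectedComponentMk i :=
      (auxLabel_eq_of_auxReach o hve).symm.trans hli
    obtain ⟨p⟩ := (SimpleGraph.ConnectedComponent.exact he).symm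
    cases p with
    | nil => exact ⟨_, adj_tail_head o e⟩
    | cons h _ => exact ⟨_, h⟩
  · rintro ⟨i, ⟨hi, j, hij⟩, rfl⟩
    obtain ⟨e, he⟩ := exists_tail_head_of_adj o hij
    have hie : i = o.tail e ∨ i = o.head e := by rcases he with h | h <;> simp [h]
    have hcyc : (system o).AuxOnCycle (matching o) (vQ (.inl (.inr e))) :=
      transGen_wQ_wQ o hie hie
    have hl : auxLabel o (vQ (.inl (.inr e))) = G.connectedComponentMk i :=
      (connectedComponentMk_of_mem o hie).symm
    refine ⟨⟨_, hcyc, by rw [auxClass_eq o hcyc, hl], fun u hu hreach => ⟨hu, ?_⟩⟩,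
      vQ (.inl (.inr e)), ⟨hcyc, hl⟩, .inl i, Finset.mem_map_of_mem _ hi, auxReach_wQ_wT o hie⟩
    rw [← auxLabel_eq_of_auxReach o hreach, hl]

end AuxGraph

/-- The feasible sets are the sets of at most `k` nodes that meet every connected component. -/
theorem feasible_iff (o : EdgeOrientation G) (k : ℕ) (S : Finset (Fin N)) :
    Feasible o k S ↔ (∀ v, ∃ s ∈ S, G.Reachable s v) ∧ S.card ≤ k := by
  classical
  constructor
  · rintro ⟨h₁, -, hk⟩
    refine ⟨fun v => ?_, hk⟩
    obtain ⟨s, hs, hsv⟩ := exists_mem_of_rankDualIndep_compl (c := G.connectedComponentMk)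
      (fun S => by convert rho₁_eq o S) (by convert h₁) v
    exact ⟨s, hs, SimpleGraph.ConnectedComponent.exact hsv⟩
  · rintro ⟨h, hk⟩
    refine ⟨?_, ?_, hk⟩
    · have := rankDualIndep_compl_of_forall (ρ := rho₁ o) (p := fun _ => True)
        (c := G.connectedComponentMk) (S := S)
        (fun S => by rw [rho₁_eq o S, Finset.filter_true]) fun v _ => by
          obtain ⟨s, hs, hsv⟩ := h v
          exact ⟨s, hs, trivial, SimpleGraph.ConnectedComponent.sound hsv⟩
      convert this
    -- The blocks of the second matroid are the components with an edge, so a set meeting all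
    -- components meets all of them. A chosen node in the component of a non-isolated node is itself
    -- non-isolated.
    · have := rankDualIndep_compl_of_forall (ρ := rho₂ o) (S := S)
        (p := fun i => ∃ j, G.Adj i j) (c := fun i => {u | (system o).AuxOnCycle (matching o) u ∧
          auxLabel o u = G.connectedComponentMk i})
        (fun S => by
          unfold rho₂
          convert systemRho₂_eq o S) fun v hv => by
          obtain ⟨s, hs, hsv⟩ := h v
          have hc := SimpleGraph.ConnectedComponent.sound hsv
          refine ⟨s, hs, ?_, by simp only [hc]⟩
          obtain ⟨p⟩ := hsv
          cases p with
          | nil => exact hv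
          | cons h _ => exact ⟨_, h⟩
      convert this

end Consensus

/-! ### Greedy maximization of block-separable submodular functions -/

section Greedy

set_option linter.unusedSectionVars false

variable {V β : Type*} [DecidableEq V] [Fintype β] [DecidableEq β] {f : Finset V → ℝ} {c : V → β}

theorem IsMonotoneSubmodular.marginal_insert_le (hf : IsMonotoneSubmodular f) (S : Finset V)
    (u v : V) :
    f (insert u (insert v S)) - f (insert v S) ≤ f (insert u S) - f S := by
  by_cases hu : u ∈ insert v S
  · rw [Finset.insert_eq_of_mem hu, sub_self]
    exact sub_nonneg.2 (hf.mono _ _ (Finset.subset_insert _ _))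
  · exact hf.submodular _ _ (Finset.subset_insert _ _) _ hu

theorem IsMonotoneSubmodular.union_sub_le (hf : IsMonotoneSubmodular f) {S O : Finset V} {g : ℝ}
    (hg : ∀ u ∈ O, f (insert u S) - f S ≤ g) : f (S ∪ O) - f S ≤ O.card * g := by
  induction O using Finset.induction_on with
  | empty => simp
  | insert u O hu ih =>
    have h1 := ih fun w hw => hg w (Finset.mem_insert_of_mem hw)
    have h2 := hg u (Finset.mem_insert_self u O)
    have h3 : f (insert u (S ∪ O)) - f (S ∪ O) ≤ f (insert u S) - f S := by
      by_cases hu' : u ∈ S ∪ O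
      · rw [Finset.insert_eq_of_mem hu', sub_self]
        exact sub_nonneg.2 (hf.mono _ _ (Finset.subset_insert _ _))
      · exact hf.submodular _ _ Finset.subset_union_left _ hu'
    rw [Finset.union_insert, Finset.card_insert_of_notMem hu]
    push_cast
    linarith

/-- Up to its value at the empty set, `f` is the sum of its values on the blocks, the fibres of `c`. -/
def IsBlockSeparable (f : Finset V → ℝ) (c : V → β) : Prop :=
  ∀ S, f S - f ∅ = ∑ b, (f {v ∈ S | c v = b} - f ∅)

theorem IsBlockSeparable.sub_eq (hs : IsBlockSeparable f c) {A B : Finset V} (b : β)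
    (h : ∀ b' ≠ b, A.filter (c · = b') = B.filter (c · = b')) :
    f A - f B = f (A.filter (c · = b)) - f (B.filter (c · = b)) := by
  have hA := hs A
  have hB := hs B
  rw [← Finset.add_sum_erase _ _ (Finset.mem_univ b)] at hA hB
  have : ∑ x ∈ Finset.univ.erase b, (f (A.filter (c · = x)) - f ∅) =
      ∑ x ∈ Finset.univ.erase b, (f (B.filter (c · = x)) - f ∅) :=
    Finset.sum_congr rfl fun x hx => by rw [h x (Finset.ne_of_mem_erase hx)]
  linarith

theorem filter_insert_of_block_ne {v : V} {b : β} (h : c v ≠ b) (S : Finset V) :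
    (insert v S).filter (c · = b) = S.filter (c · = b) := by
  rw [Finset.filter_insert, if_neg h]

theorem IsBlockSeparable.insert_sub_eq (hs : IsBlockSeparable f c) (S : Finset V) (v : V) :
    f (insert v S) - f S =
      f ((insert v S).filter (c · = c v)) - f (S.filter (c · = c v)) :=
  hs.sub_eq (c v) fun _ h => filter_insert_of_block_ne h.symm S

/-- The usual bound of a gap by the number of missing elements times the largest marginal;
separability allows marginals at all of `S` in place of its part in the block. -/
theorem IsBlockSeparable.sub_block_le (hf : IsMonotoneSubmodular f) (hs : IsBlockSeparable f c)
    {S O : Finset V} {b : β} {g : ℝ} (hO : ∀ v ∈ O, c v = b)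
    (hg : ∀ u, c u = b → f (insert u S) - f S ≤ g) :
    f O - f (S.filter (c · = b)) ≤ O.card * g := by
  refine le_trans ?_ (hf.union_sub_le fun u hu => hg u (hO u hu))
  rw [hs.sub_eq (A := S ∪ O) (B := S) b]
  · refine sub_le_sub_right (hf.mono _ _ fun v hv => ?_) _
    simp [hv, hO v hv]
  · intro b' hb'
    rw [Finset.filter_union, Finset.filter_false_of_mem (s := O), Finset.union_empty]
    intro v hv hvb
    exact hb' (hvb.symm.trans (hO v hv))

/-- The gap to every subset of a block has decayed geometrically with the number of elements
selected from that block. -/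
def GreedyDecay (f : Finset V → ℝ) (c : V → β) (S : Finset V) : Prop :=
  ∀ (b : β) (O : Finset V), O.Nonempty → (∀ v ∈ O, c v = b) →
    f O - f {v ∈ S | c v = b} ≤ (1 - 1 / O.card) ^ ({v ∈ S | c v = b}).card * (f O - f ∅)

/-- Every element selected from a block beyond the size of `O` has gained at least the present
marginal value of each element. -/
def GreedyBalance (f : Finset V → ℝ) (c : V → β) (S : Finset V) : Prop :=
  ∀ (b : β) (O : Finset V) (u : V), O.Nonempty → (∀ v ∈ O, c v = b) →
    O.card ≤ ({v ∈ S | c v = b}).card →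
    (1 - 1 / Real.exp 1) * (f O - f ∅) +
      (({v ∈ S | c v = b}).card - O.card) * (f (insert u S) - f S) ≤ f {v ∈ S | c v = b} - f ∅

theorem greedyDecay_empty (f : Finset V → ℝ) (c : V → β) : GreedyDecay f c ∅ := by
  intro b O _ _
  simp

theorem one_sub_one_div_card_nonneg {O : Finset V} (hO : O.Nonempty) :
    (0 : ℝ) ≤ 1 - 1 / O.card := by
  have : (1 : ℝ) ≤ O.card := by exact_mod_cast hO.card_pos
  rw [sub_nonneg, div_le_one (by linarith)]
  exact this

/-- The best node of a block gains at least the fraction `1 / |O|` of the gap to `O`. Optimality is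
needed only within that block, so the lemma applies in both phases. -/
theorem GreedyDecay.insert_best (hf : IsMonotoneSubmodular f) (hs : IsBlockSeparable f c)
    {S : Finset V} {v : V} (hS : GreedyDecay f c S) (hv : v ∉ S)
    (hbest : ∀ u, c u = c v → f (insert u S) ≤ f (insert v S)) :
    GreedyDecay f c (insert v S) := by
  intro b O hne hO
  by_cases hb : c v = b
  · subst hb
    have h1 := hS (c v) O hne hO
    have h2 := hs.sub_block_le hf (S := S) (g := f (insert v S) - f S) hO fun u hu =>
      sub_le_sub_right (hbest u hu) _
    have h3 := hs.insert_sub_eq S v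
    have hcard : ((insert v S).filter (c · = c v)).card = (S.filter (c · = c v)).card + 1 := by
      rw [Finset.filter_insert, if_pos rfl, Finset.card_insert_of_notMem]
      simp [hv]
    have hκ : (0 : ℝ) < O.card := by exact_mod_cast hne.card_pos
    have h4 := mul_le_mul_of_nonneg_left h1 (one_sub_one_div_card_nonneg hne)
    rw [hcard, pow_succ']
    have h5 : (f O - f (S.filter (c · = c v))) / O.card ≤ f (insert v S) - f S := by
      rw [div_le_iff₀ hκ]
      linarith
    have h6 : (1 - 1 / (O.card : ℝ)) * (f O - f (S.filter (c · = c v))) =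
      (f O - f (S.filter (c · = c v))) - (f O - f (S.filter (c · = c v))) / O.card := by ring
    rw [mul_assoc]
    linarith
  · rw [filter_insert_of_block_ne hb]
    exact hS b O hne hO

theorem one_sub_one_div_pow_le_exp {κ : ℕ} (hκ : 0 < κ) (j : ℕ) :
    (1 - 1 / (κ : ℝ)) ^ j ≤ Real.exp (-(j / κ)) := by
  have hκ' : (1 : ℝ) ≤ κ := by exact_mod_cast hκ
  have h0 : (0 : ℝ) ≤ 1 - 1 / κ := by
    rw [sub_nonneg, div_le_one (by linarith)]
    exact hκ'
  have h1 : 1 - 1 / (κ : ℝ) ≤ Real.exp (-(1 / κ)) := by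
    have := Real.add_one_le_exp (-(1 / (κ : ℝ)))
    linarith
  calc (1 - 1 / (κ : ℝ)) ^ j ≤ Real.exp (-(1 / κ)) ^ j := pow_le_pow_left₀ h0 h1 j
    _ = Real.exp (-(j / κ)) := by
      rw [← Real.exp_nat_mul]
      congr 1
      ring

theorem GreedyDecay.le_of_card_eq (hf : IsMonotoneSubmodular f) {S O : Finset V} {b : β}
    (hS : GreedyDecay f c S) (hne : O.Nonempty) (hO : ∀ v ∈ O, c v = b)
    (hcard : O.card = (S.filter (c · = b)).card) :
    (1 - 1 / Real.exp 1) * (f O - f ∅) ≤ f (S.filter (c · = b)) - f ∅ := by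
  have h1 := hS b O hne hO
  have h2 := one_sub_one_div_pow_le_exp hne.card_pos O.card
  rw [div_self (by exact_mod_cast hne.card_pos.ne'), Real.exp_neg, ← one_div] at h2
  rw [← hcard] at h1
  have h3 : 0 ≤ f O - f ∅ := sub_nonneg.2 (hf.mono _ _ (Finset.empty_subset _))
  nlinarith [mul_le_mul_of_nonneg_right h2 h3]

/-- With at most one selected node per block, a nonempty `O` no larger than the selection has
exactly its size, so the surplus term vanishes and decay suffices. -/
theorem GreedyDecay.balance_of_injOn (hf : IsMonotoneSubmodular f) {S : Finset V}
    (hS : GreedyDecay f c S) (hinj : Set.InjOn c S) : GreedyBalance f c S := by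
  intro b O u hne hO hle
  have h1 : (S.filter (c · = b)).card ≤ 1 := by
    rw [Finset.card_le_one]
    intro x hx y hy
    rw [Finset.mem_filter] at hx hy
    exact hinj hx.1 hy.1 (hx.2.trans hy.2.symm)
  have hcard : O.card = (S.filter (c · = b)).card := by
    have := hne.card_pos
    omega
  rw [← hcard, sub_self, zero_mul, add_zero]
  exact hS.le_of_card_eq hf hne hO hcard

/-- The new gain bounds every later marginal, so the surplus term may grow by one such gain. When
the block has just reached the size of `O`, decay starts the count; in other blocks marginals only
shrink. Here the node must be best over all blocks. -/
theorem GreedyBalance.insert_best (hf : IsMonotoneSubmodular f) (hs : IsBlockSeparable f c)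
    {S : Finset V} {v : V} (hS : GreedyBalance f c S) (hS' : GreedyDecay f c (insert v S))
    (hv : v ∉ S) (hbest : ∀ u, f (insert u S) ≤ f (insert v S)) :
    GreedyBalance f c (insert v S) := by
  intro b O u hne hO hle
  by_cases hb : c v = b
  · subst hb
    rcases hle.lt_or_eq with hlt | heq
    · have hcard : ((insert v S).filter (c · = c v)).card = (S.filter (c · = c v)).card + 1 := by
        rw [Finset.filter_insert, if_pos rfl, Finset.card_insert_of_notMem]
        simp [hv]
      have h1 := hS (c v) O v hne hO (by omega)
      have h2 := hs.insert_sub_eq S v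
      have h3 : f (insert u (insert v S)) - f (insert v S) ≤ f (insert v S) - f S :=
        (hf.marginal_insert_le S u v).trans (sub_le_sub_right (hbest u) _)
      have h4 : (0 : ℝ) ≤ (S.filter (c · = c v)).card + 1 - O.card := by
        have : (O.card : ℝ) ≤ (S.filter (c · = c v)).card + 1 := by
          rw [hcard] at hle
          exact_mod_cast hle
        linarith
      rw [hcard]
      push_cast
      have h5 := mul_le_mul_of_nonneg_left h3 h4
      linarith
    · rw [← heq, sub_self, zero_mul, add_zero]
      exact hS'.le_of_card_eq hf hne hO heq
  · rw [filter_insert_of_block_ne hb] at hle ⊢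
    have h1 := hS b O u hne hO hle
    have h4 : (0 : ℝ) ≤ (S.filter (c · = b)).card - O.card := by
      rw [sub_nonneg]
      exact_mod_cast hle
    have h5 := mul_le_mul_of_nonneg_left (hf.marginal_insert_le S u v) h4
    linarith

/-- With `x = j / κ` this is `x * exp (-x) ≤ 1 / e`, from `x ≤ exp (x - 1)`. -/
theorem div_mul_one_sub_one_div_pow_le {κ : ℕ} (hκ : 0 < κ) (j : ℕ) :
    (j / κ : ℝ) * (1 - 1 / (κ : ℝ)) ^ j ≤ 1 / Real.exp 1 := by
  have h1 := one_sub_one_div_pow_le_exp hκ j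
  have h2 : (j / κ : ℝ) ≤ Real.exp (j / κ - 1) := by
    have := Real.add_one_le_exp ((j / κ : ℝ) - 1)
    linarith
  have h0 : (0 : ℝ) ≤ j / κ := by positivity
  calc (j / κ : ℝ) * (1 - 1 / (κ : ℝ)) ^ j ≤ (j / κ : ℝ) * Real.exp (-(j / κ)) :=
        mul_le_mul_of_nonneg_left h1 h0
    _ ≤ Real.exp (j / κ - 1) * Real.exp (-(j / κ)) :=
        mul_le_mul_of_nonneg_right h2 (Real.exp_pos _).le
    _ = 1 / Real.exp 1 := by
        rw [← Real.exp_add, one_div, ← Real.exp_neg]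
        congr 1
        ring

/-- The approximation guarantee of the greedy algorithm. -/
theorem GreedyBalance.le_of_card_le [Fintype V] (hf : IsMonotoneSubmodular f)
    (hs : IsBlockSeparable f c) {S O : Finset V} (hB : GreedyBalance f c S)
    (hD : GreedyDecay f c S) (hO : ∀ b, (O.filter (c · = b)).Nonempty)
    (hcard : O.card ≤ S.card) :
    (1 - 1 / Real.exp 1) * f O ≤ f S := by
  have he : (0 : ℝ) < 1 / Real.exp 1 := by positivity
  obtain hV | hV := isEmpty_or_nonempty V
  · rw [Subsingleton.elim S O]
    nlinarith [hf.nonneg O]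
  obtain ⟨u, -, hu⟩ := Finset.exists_max_image Finset.univ (fun u => f (insert u S))
    Finset.univ_nonempty
  set θ := f (insert u S) - f S with hθ
  have hθ0 : 0 ≤ θ := sub_nonneg.2 (hf.mono _ _ (Finset.subset_insert _ _))
  -- The marginal `θ` is a common price for a node, so that blocks where `S` has too many nodes pay
  -- for those where it has too few.
  have hblock : ∀ b, (1 - 1 / Real.exp 1) * (f (O.filter (c · = b)) - f ∅) ≤
      (f (S.filter (c · = b)) - f ∅) +
        θ * ((O.filter (c · = b)).card - (S.filter (c · = b)).card) := by
    intro b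
    have hOb : ∀ v ∈ O.filter (c · = b), c v = b := fun v hv => (Finset.mem_filter.1 hv).2
    rcases le_total (O.filter (c · = b)).card (S.filter (c · = b)).card with hle | hle
    · have := hB b _ u (hO b) hOb hle
      linarith
    · have h1 := hD b _ (hO b) hOb
      have h2 := hs.sub_block_le hf (S := S) (g := θ) hOb fun w _ =>
        sub_le_sub_right (hu w (Finset.mem_univ w)) _
      have h3 := div_mul_one_sub_one_div_pow_le (hO b).card_pos (S.filter (c · = b)).card
      have h4 : 0 ≤ f (O.filter (c · = b)) - f ∅ :=
        sub_nonneg.2 (hf.mono _ _ (Finset.empty_subset _))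
      have hκ : (0 : ℝ) < (O.filter (c · = b)).card := by exact_mod_cast (hO b).card_pos
      have hle' : ((S.filter (c · = b)).card : ℝ) ≤ (O.filter (c · = b)).card := by
        exact_mod_cast hle
      generalize f (O.filter (c · = b)) = FO at *
      generalize f (S.filter (c · = b)) = FS at *
      generalize ((O.filter (c · = b)).card : ℝ) = κ at *
      generalize hj : (S.filter (c · = b)).card = j at *
      -- The gap `FO - FS` splits into the shares `j / κ` and `1 - j / κ`: the first is bounded by
      -- decay, the second by the price `θ`.
      have h5 : (j / κ : ℝ) * (FO - FS) ≤ 1 / Real.exp 1 * (FO - f ∅) :=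
        calc (j / κ : ℝ) * (FO - FS) ≤ (j / κ) * ((1 - 1 / κ) ^ j * (FO - f ∅)) :=
              mul_le_mul_of_nonneg_left h1 (by positivity)
          _ ≤ _ := by
              rw [← mul_assoc]
              exact mul_le_mul_of_nonneg_right h3 h4
      have h6 : (FO - FS) / κ * (κ - j) ≤ θ * (κ - j) := by
        refine mul_le_mul_of_nonneg_right ?_ (by linarith)
        rw [div_le_iff₀ hκ]
        linarith
      have h7 : (FO - FS) / κ * (κ - j) = (FO - FS) - j / κ * (FO - FS) := by
        field_simp
      linarith
  have hsum := Finset.sum_le_sum fun b (_ : b ∈ Finset.univ) => hblock b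
  rw [← Finset.mul_sum, Finset.sum_add_distrib, ← Finset.mul_sum, ← hs O, ← hs S,
    Finset.sum_sub_distrib] at hsum
  have hcO : ∑ b, ((O.filter (c · = b)).card : ℝ) = O.card := by
    exact_mod_cast (Finset.card_eq_sum_card_fiberwise fun _ _ => Finset.mem_univ _).symm
  have hcS : ∑ b, ((S.filter (c · = b)).card : ℝ) = S.card := by
    exact_mod_cast (Finset.card_eq_sum_card_fiberwise fun _ _ => Finset.mem_univ _).symm
  rw [hcO, hcS] at hsum
  have hcard' : (O.card : ℝ) ≤ S.card := by exact_mod_cast hcard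
  have h0 := hf.nonneg ∅
  nlinarith [mul_nonneg hθ0 (sub_nonneg.2 hcard')]

end Greedy

/-! ### Objectives that separate over the connected components -/

theorem isBlockSeparable_of_isSeparableOverComponents {V : Type*} [DecidableEq V]
    {G : SimpleGraph V} [Fintype G.ConnectedComponent] [DecidableEq G.ConnectedComponent]
    {f : Finset V → ℝ} (h : IsSeparableOverComponents G f) :
    IsBlockSeparable f G.connectedComponentMk := by
  classical
  obtain ⟨g, hg⟩ := h
  have hg' : ∀ S, f S = ∑ c, g c (S.filter (G.connectedComponentMk · = c)) := by
    intro S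
    rw [hg, finsum_eq_sum_of_fintype]
    refine Finset.sum_congr rfl fun c _ => ?_
    congr
  intro S
  rw [hg' S, hg' ∅, ← Finset.sum_sub_distrib]
  refine Finset.sum_congr rfl fun b _ => ?_
  rw [hg' (S.filter _), ← hg' ∅, hg' ∅, ← Finset.sum_sub_distrib,
    Finset.sum_eq_single b]
  · simp [Finset.filter_filter]
  · intro b' _ hb'
    rw [Finset.filter_filter, Finset.filter_false_of_mem, Finset.filter_empty, sub_self]
    rintro v _ ⟨rfl, h⟩
    exact hb' h.symm
  · simp

theorem isBlockSeparable_of_preconnected {V : Type*} [DecidableEq V]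
    {G : SimpleGraph V} [Fintype G.ConnectedComponent] [DecidableEq G.ConnectedComponent]
    (h : G.Preconnected) (f : Finset V → ℝ) :
    IsBlockSeparable f G.connectedComponentMk := by
  intro S
  obtain rfl | ⟨v, hv⟩ := S.eq_empty_or_nonempty
  · simp
  · rw [Finset.sum_eq_single (G.connectedComponentMk v)]
    · rw [Finset.filter_true_of_mem]
      intro w _
      exact SimpleGraph.ConnectedComponent.sound (h w v)
    · intro b _ hb
      induction b using SimpleGraph.ConnectedComponent.ind with
      | h w => exact (hb (SimpleGraph.ConnectedComponent.sound (h w v))).elim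
    · simp

namespace Machine

variable {N : ℕ} {G : SimpleGraph (Fin N)} {f : Finset (Fin N) → ℝ}

/-! ### Total correctness with time bounds -/

/-- Started in `s`, the program halts within `T` steps in a store that satisfies `Q`. -/
def Halts (G : SimpleGraph (Fin N)) (f : Finset (Fin N) → ℝ) (P : Prog) (s : Store) (T : ℕ)
    (Q : Store → Prop) : Prop :=
  ∃ t s', Exec G f P s t s' ∧ t ≤ T ∧ Q s'

namespace Halts

variable {P P' : Prog} {s : Store} {T T' : ℕ} {Q R : Store → Prop}

theorem mono (h : Halts G f P s T Q) (hT : T ≤ T') (hQ : ∀ s', Q s' → R s') :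
    Halts G f P s T' R := by
  obtain ⟨t, s', he, ht, hq⟩ := h
  exact ⟨t, s', he, ht.trans hT, hQ s' hq⟩

theorem instr {c : Instr} (h : Q (c.run f s)) : Halts G f (.instr c) s (T + 1) Q :=
  ⟨1, _, .instr c s, Nat.le_add_left 1 T, h⟩

theorem seq (h : Halts G f P s T R) (h' : ∀ s', R s' → Halts G f P' s' T' Q) :
    Halts G f (.seq P P') s (T + T') Q := by
  obtain ⟨t, s₁, he, ht, hr⟩ := h
  obtain ⟨t', s₂, he', ht', hq⟩ := h' s₁ hr
  exact ⟨t + t', s₂, .seq he he', Nat.add_le_add ht ht', hq⟩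

theorem instr_seq {c : Instr} (h : Halts G f P (c.run f s) T Q) :
    Halts G f (.seq (.instr c) P) s (T + 1) Q := by
  obtain ⟨t, s₁, he, ht, hq⟩ := h
  exact ⟨1 + t, s₁, .seq (.instr c s) he, by omega, hq⟩

theorem cond {b : Test} (h : b.holds G s → Halts G f P s T Q)
    (h' : ¬ b.holds G s → Halts G f P' s T Q) : Halts G f (.cond b P P') s (T + 1) Q := by
  by_cases hb : b.holds G s
  · obtain ⟨t, s₁, he, ht, hq⟩ := h hb
    exact ⟨t + 1, s₁, .condTrue hb he, Nat.add_le_add_right ht 1, hq⟩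
  · obtain ⟨t, s₁, he, ht, hq⟩ := h' hb
    exact ⟨t + 1, s₁, .condFalse hb he, Nat.add_le_add_right ht 1, hq⟩

end Halts

/-- Run `B` with register `i` counting from `0` up to the contents of register `0`. -/
def forLoop (i : ℕ) (B : Prog) : Prog :=
  .seq (.instr (.zero i)) (.loop (.intLt i 0) (.seq B (.instr (.succ i))))

/-- Each iteration costs the body plus one increment and one test; the final `2` is the
initialization and the failing test. -/
theorem Halts.forLoop {i : ℕ} {B : Prog} {s : Store} {T : ℕ} (Inv : ℕ → Store → Prop)
    (hinit : Inv 0 ((Instr.zero i).run f s))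
    (hcount : ∀ j s, Inv j s → s.int i = j ∧ s.int 0 = N)
    (hstep : ∀ j < N, ∀ s, Inv j s →
      Halts G f B s T fun s' => Inv (j + 1) ((Instr.succ i).run f s')) :
    Halts G f (forLoop i B) s (N * (T + 2) + 2) (Inv N) := by
  have hloop : ∀ m j s, j + m = N → Inv j s →
      Halts G f (.loop (.intLt i 0) (.seq B (.instr (.succ i)))) s (m * (T + 2) + 1) (Inv N) := by
    intro m
    induction m with
    | zero =>
      intro j s hj hs
      obtain ⟨h1, h2⟩ := hcount j s hs
      have hjN : j = N := by omega
      subst hjN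
      refine ⟨1, s, .loopDone ?_, by omega, hs⟩
      simp only [Test.holds]
      omega
    | succ m ih =>
      intro j s hj hs
      obtain ⟨h1, h2⟩ := hcount j s hs
      obtain ⟨t, s₁, he, ht, hq⟩ := hstep j (by omega) s hs
      obtain ⟨t', s₂, he', ht', hq'⟩ := ih (j + 1) _ (by omega) hq
      refine ⟨(t + 1) + t' + 1, s₂, .loopStep ?_ (.seq he (.instr _ _)) he', ?_, hq'⟩
      · simp only [Test.holds]
        omega
      · rw [Nat.succ_mul]
        omega
  exact (Halts.instr_seq (hloop N 0 _ (by omega) hinit)).mono (by omega) fun _ h => h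

/-! ### The greedy program

Register `0` holds `N`, register `1` the bound `k`, register `2` counts rounds, registers `3`, `4`
and `5` are loop variables, register `6` holds the best candidate, register `7` the number of
selected nodes, registers `8` and `9` the constants one and zero. Array `0` is the selected set and
array `1` the set of nodes in the components it meets. -/

/-- An instruction that changes nothing as long as register `9` holds zero. -/
def skip : Prog := .instr (.zero 9)

/-- Make the node in register `3` the best candidate. -/
def take : Prog := .seq (.instr (.copy 6 3)) (.instr (.realCopy 0 1))

/-- Compare the node in register `3` with the best candidate, unless it is marked in array `m`. -/
def scanBody (m : ℕ) : Prog :=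
  .seq (.instr (.load 10 m 3)) <| .cond (.intEq 10 9)
    (.seq (.instr (.store 0 3 8)) <| .seq (.instr (.query 1 0)) <| .seq (.instr (.store 0 3 9)) <|
      .cond (.intEq 6 0) take (.cond (.realLt 0 1) take skip))
    skip

/-- Find the best candidate among the nodes that are not marked in array `m`. -/
def select (m : ℕ) : Prog := .seq (.instr (.copy 6 0)) (forLoop 3 (scanBody m))

/-- If the node in register `4` is in array `1`, add its neighbour in register `5`. -/
def expandBody : Prog :=
  .seq (.instr (.load 10 1 4)) <| .cond (.intEq 10 9) skip
    (.cond (.adj 4 5) (.instr (.store 1 5 8)) skip)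

/-- Add all neighbours of array `1` to array `1`. -/
def sweep : Prog := forLoop 4 (forLoop 5 expandBody)

/-- Close array `1` under adjacency. -/
def close : Prog := forLoop 3 sweep

/-- Select the best node in the components that have not been met yet. -/
def coverRound : Prog :=
  .seq (select 1) <| .cond (.intLt 6 0)
    (.seq (.instr (.store 0 6 8)) <| .seq (.instr (.store 1 6 8)) <| .seq (.instr (.succ 7)) close)
    skip

/-- Select the best remaining node if fewer than `k` nodes have been selected. -/
def fillRound : Prog :=
  .cond (.intLt 7 1)
    (.seq (select 0) <| .cond (.intLt 6 0) (.seq (.instr (.store 0 6 8)) (.instr (.succ 7))) skip)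
    skip

/-- The greedy algorithm. -/
def greedy : Prog :=
  .seq (.instr (.succ 8)) (.seq (forLoop 2 coverRound) (forLoop 2 fillRound))

/-! ### Correctness of the program -/

/-- The store holds the selected set `S`, the set `R` of covered nodes and the round counter `t`. -/
structure Rep (k t : ℕ) (S R : Finset (Fin N)) (s : Store) : Prop where
  size : s.int 0 = N
  bound : s.int 1 = k
  round : s.int 2 = t
  count : s.int 7 = S.card
  one : s.int 8 = 1
  zero : s.int 9 = 0
  selected : s.set N 0 = S
  covered : s.set N 1 = R

section

variable {k t : ℕ} {S R : Finset (Fin N)} {s s' : Store}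

theorem Rep.congr (h : Rep k t S R s) (h0 : s'.int 0 = s.int 0 := by rfl)
    (h1 : s'.int 1 = s.int 1 := by rfl) (h2 : s'.int 2 = s.int 2 := by rfl)
    (h7 : s'.int 7 = s.int 7 := by rfl) (h8 : s'.int 8 = s.int 8 := by rfl)
    (h9 : s'.int 9 = s.int 9 := by rfl) (hsel : s'.set N 0 = s.set N 0 := by rfl)
    (hcov : s'.set N 1 = s.set N 1 := by rfl) : Rep k t S R s' :=
  ⟨h0.trans h.size, h1.trans h.bound, h2.trans h.round, h7.trans h.count, h8.trans h.one,
    h9.trans h.zero, hsel.trans h.selected, hcov.trans h.covered⟩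

theorem mem_set {a : ℕ} {v : Fin N} : v ∈ s.set N a ↔ s.arr a v ≠ 0 := by
  simp [Store.set]

theorem set_store_insert {a i x : ℕ} {v : Fin N} (hi : s.int i = v) (hx : s.int x ≠ 0) :
    ((Instr.store a i x).run f s).set N a = insert v (s.set N a) := by
  ext u
  rw [Finset.mem_insert, mem_set, mem_set]
  by_cases h : u = v
  · simp [Instr.run, hi, h, hx]
  · simp [Instr.run, hi, h, Fin.val_inj]

theorem set_store_erase {a i x : ℕ} {v : Fin N} (hi : s.int i = v) (hx : s.int x = 0) :
    ((Instr.store a i x).run f s).set N a = (s.set N a).erase v := by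
  ext u
  rw [Finset.mem_erase, mem_set, mem_set]
  by_cases h : u = v
  · simp [Instr.run, hi, h, hx]
  · simp [Instr.run, hi, h, Fin.val_inj]

theorem set_store_of_ne {a a' i x : ℕ} (h : a' ≠ a) :
    ((Instr.store a i x).run f s).set N a' = s.set N a' := by
  ext u
  simp [mem_set, Instr.run, h]

theorem Rep.skip (h : Rep k t S R s) : Rep k t S R ((Instr.zero 9).run f s) :=
  h.congr (h9 := h.zero.symm)

/-- The best of the first `j` nodes outside `M` is held in register `6`. -/
def IsBest (f : Finset (Fin N) → ℝ) (S M : Finset (Fin N)) (j : ℕ) (s : Store) : Prop :=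
  (s.int 6 = N ∧ ∀ u : Fin N, u.val < j → u ∈ M) ∨
    ∃ v : Fin N, s.int 6 = v ∧ v ∉ M ∧ s.real 0 = f (insert v S) ∧
      ∀ u : Fin N, u.val < j → u ∉ M → f (insert u S) ≤ f (insert v S)

/-- The candidate is written into array `0` for one oracle call and then erased, which restores `S`
because unmarked nodes lie outside `S`. The value `N` in register `6` means that no candidate has
been found. -/
theorem halts_scanBody {m j : ℕ} {M : Finset (Fin N)} (hj : j < N) (h : Rep k t S R s)
    (hm : s.set N m = M) (hSM : S ⊆ M) (h3 : s.int 3 = j) (hbest : IsBest f S M j s) :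
    Halts G f (scanBody m) s 9 fun s' =>
      Rep k t S R s' ∧ s'.int 3 = j ∧ IsBest f S M (j + 1) s' := by
  refine .instr_seq (.cond (fun h10 => ?_) fun h10 => ?_)
  · have hjM : (⟨j, hj⟩ : Fin N) ∉ M := by
      rw [← hm, mem_set, not_not]
      have : s.arr m (s.int 3) = s.int 9 := h10
      rwa [h3, h.zero] at this
    have hjS : (⟨j, hj⟩ : Fin N) ∉ S := fun h => hjM (hSM h)
    set w : Fin N := ⟨j, hj⟩ with hw
    refine .instr_seq (.instr_seq (.instr_seq ?_))
    set s₀ := (Instr.load 10 m 3).run f s with hs₀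
    set s₁ := (Instr.store 0 3 8).run f s₀ with hs₁
    set s₂ := (Instr.query 1 0).run f s₁ with hs₂
    set s₃ := (Instr.store 0 3 9).run f s₂ with hs₃
    have hset₁ : s₁.set N 0 = insert w S := by
      rw [hs₁, set_store_insert (s := s₀) (i := 3) (v := w) h3, ← h.selected]
      · rfl
      · change s.int 8 ≠ 0
        rw [h.one]
        exact one_ne_zero
    have hset₃ : s₃.set N 0 = S := by
      rw [hs₃, set_store_erase (s := s₂) (i := 3) (x := 9) (v := w) h3 h.zero]
      change (s₁.set N 0).erase w = S
      rw [hset₁, Finset.erase_insert hjS]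
    have hrep : Rep k t S R s₃ := h.congr (hsel := hset₃.trans h.selected.symm)
      (hcov := (set_store_of_ne (s := s₂) one_ne_zero).trans
        (set_store_of_ne (f := f) (s := s₀) (i := 3) (x := 8) one_ne_zero))
    have hreal₁ : s₃.real 1 = f (insert w S) := by
      rw [← hset₁]
      rfl
    have hint₆ : s₃.int 6 = s.int 6 := rfl
    have hreal₀ : s₃.real 0 = s.real 0 := rfl
    have htake : (∀ u : Fin N, u.val < j → u ∉ M → f (insert u S) ≤ f (insert w S)) →
        Halts G f take s₃ 2 fun s' =>
          Rep k t S R s' ∧ s'.int 3 = j ∧ IsBest f S M (j + 1) s' := by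
      intro hle
      refine .instr_seq (.instr ⟨hrep.congr, h3, Or.inr ⟨w, h3, hjM, hreal₁, fun u hu huM => ?_⟩⟩)
      rcases Nat.lt_succ_iff_lt_or_eq.1 hu with hu | hu
      · exact hle u hu huM
      · rw [show u = w from Fin.ext hu]
    refine .cond (fun h6 => (htake ?_).mono (by omega) fun _ h => h) fun h6 => ?_
    · have h6' : s.int 6 = N := Eq.trans (show s.int 6 = s.int 0 from h6) h.size
      rcases hbest with ⟨-, hb⟩ | ⟨v, hv, -⟩
      · exact fun u hu huM => (huM (hb u hu)).elim
      · have := v.2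
        omega
    · have h6' : s.int 6 ≠ N := fun hc => h6 (show s.int 6 = s.int 0 from hc.trans h.size.symm)
      rcases hbest with ⟨hb, -⟩ | ⟨v, hv, hvM, hvr, hvb⟩
      · exact (h6' hb).elim
      · refine .cond (fun hlt => htake fun u hu huM => (hvb u hu huM).trans ?_) fun hlt => ?_
        · have : s₃.real 0 < s₃.real 1 := hlt
          rw [hreal₁, hreal₀, hvr] at this
          exact this.le
        · have hle : ¬ s₃.real 0 < s₃.real 1 := hlt
          rw [hreal₁, hreal₀, hvr, not_lt] at hle
          refine .instr ⟨hrep.skip, h3, Or.inr ⟨v, hv, hvM, hvr, fun u hu huM => ?_⟩⟩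
          rcases Nat.lt_succ_iff_lt_or_eq.1 hu with hu | hu
          · exact hvb u hu huM
          · rw [show u = w from Fin.ext hu]
            exact hle
  · have hjM : (⟨j, hj⟩ : Fin N) ∈ M := by
      rw [← hm, mem_set]
      intro h0
      apply h10
      change s.arr m (s.int 3) = s.int 9
      rw [h3, h.zero]
      exact h0
    have hrep : Rep k t S R ((Instr.load 10 m 3).run f s) := h.congr
    refine .instr ⟨hrep.skip, h3, ?_⟩
    have hu' : ∀ u : Fin N, u.val < j + 1 → u ∉ M → u.val < j := by
      intro u hu huM
      rcases Nat.lt_succ_iff_lt_or_eq.1 hu with hu | hu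
      · exact hu
      · rw [show u = ⟨j, hj⟩ from Fin.ext hu] at huM
        exact (huM hjM).elim
    rcases hbest with ⟨h6, hb⟩ | ⟨v, hv, hvM, hvr, hvb⟩
    · refine Or.inl ⟨h6, fun u hu => ?_⟩
      by_contra huM
      exact huM (hb u (hu' u hu huM))
    · exact Or.inr ⟨v, hv, hvM, hvr, fun u hu huM => hvb u (hu' u hu huM) huM⟩

theorem halts_select {m : ℕ} {M : Finset (Fin N)} (h : Rep k t S R s)
    (hm : ∀ s, Rep k t S R s → s.set N m = M) (hSM : S ⊆ M) :
    Halts G f (select m) s (N * 11 + 3) fun s' => Rep k t S R s' ∧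
      ((s'.int 6 = N ∧ M = Finset.univ) ∨ ∃ v : Fin N, s'.int 6 = v ∧ v ∉ M ∧
        ∀ u, u ∉ M → f (insert u S) ≤ f (insert v S)) := by
  refine .instr_seq ((Halts.forLoop (T := 9)
    (fun j s => Rep k t S R s ∧ s.int 3 = j ∧ IsBest f S M j s) ?_ ?_ ?_).mono le_rfl ?_)
  · exact ⟨h.congr, rfl, Or.inl ⟨h.size, fun u hu => (Nat.not_lt_zero _ hu).elim⟩⟩
  · rintro j s ⟨h, h3, -⟩
    exact ⟨h3, h.size⟩
  · rintro j hj s ⟨h, h3, hb⟩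
    refine (halts_scanBody hj h (hm s h) hSM h3 hb).mono le_rfl ?_
    rintro s' ⟨h', h3', hb'⟩
    exact ⟨h'.congr, congrArg Nat.succ h3', hb'⟩
  · rintro s' ⟨h', -, hb⟩
    refine ⟨h', ?_⟩
    rcases hb with ⟨h6, hb⟩ | ⟨v, hv, hvM, -, hvb⟩
    · exact Or.inl ⟨h6, Finset.eq_univ_iff_forall.2 fun u => hb u u.2⟩
    · exact Or.inr ⟨v, hv, hvM, fun u huM => hvb u u.2 huM⟩

end

/-! ### Closing a set under adjacency -/

/-- The second set arises from the first by adding nodes that are reachable from it. -/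
def Expands (G : SimpleGraph (Fin N)) (R R' : Finset (Fin N)) : Prop :=
  R ⊆ R' ∧ ∀ v ∈ R', ∃ u ∈ R, G.Reachable u v

theorem Expands.refl (R : Finset (Fin N)) : Expands G R R :=
  ⟨subset_rfl, fun v hv => ⟨v, hv, .refl v⟩⟩

theorem Expands.trans {R R' R'' : Finset (Fin N)} (h : Expands G R R') (h' : Expands G R' R'') :
    Expands G R R'' := by
  refine ⟨h.1.trans h'.1, fun v hv => ?_⟩
  obtain ⟨u, hu, huv⟩ := h'.2 v hv
  obtain ⟨w, hw, hwu⟩ := h.2 u hu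
  exact ⟨w, hw, hwu.trans huv⟩

theorem Expands.insert_of_adj {R : Finset (Fin N)} {u v : Fin N} (hu : u ∈ R) (h : G.Adj u v) :
    Expands G R (insert v R) := by
  refine ⟨Finset.subset_insert _ _, fun w hw => ?_⟩
  rcases Finset.mem_insert.1 hw with rfl | hw
  · exact ⟨u, hu, h.reachable⟩
  · exact ⟨w, hw, .refl w⟩

/-- The set `R` is closed under adjacency. -/
def IsClosedUnderAdj (G : SimpleGraph (Fin N)) (R : Finset (Fin N)) : Prop :=
  ∀ u ∈ R, ∀ v, G.Adj u v → v ∈ R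

theorem IsClosedUnderAdj.mem_of_reachable {R : Finset (Fin N)} (hR : IsClosedUnderAdj G R)
    {u v : Fin N} (hu : u ∈ R) (h : G.Reachable u v) : v ∈ R := by
  obtain ⟨p⟩ := h
  induction p with
  | nil => exact hu
  | cons h _ ih => exact ih (hR _ hu _ h)

theorem IsClosedUnderAdj.eq_of_expands {R R' : Finset (Fin N)} (hR : IsClosedUnderAdj G R)
    (h : Expands G R R') : R' = R := by
  refine subset_antisymm (fun v hv => ?_) h.1
  obtain ⟨u, hu, huv⟩ := h.2 v hv
  exact hR.mem_of_reachable hu huv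

section

variable {k t : ℕ} {S R : Finset (Fin N)} {s s' : Store}

theorem halts_expandBody {a : ℕ} {u v : Fin N} (h : Rep k t S R s) (h3 : s.int 3 = a)
    (h4 : s.int 4 = u) (h5 : s.int 5 = v) :
    Halts G f expandBody s 4 fun s' => ∃ R', Rep k t S R' s' ∧ s'.int 3 = a ∧ s'.int 4 = u ∧
      s'.int 5 = v ∧ Expands G R R' ∧ (u ∈ R → G.Adj u v → v ∈ R') := by
  have hrep : Rep k t S R ((Instr.load 10 1 4).run f s) := h.congr
  refine .instr_seq (.cond (fun h10 => ?_) fun h10 => .cond (fun hadj => ?_) fun hadj => ?_)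
  · refine .instr ⟨R, hrep.skip, h3, h4, h5, .refl R, fun hu _ => ?_⟩
    rw [← h.covered, mem_set] at hu
    have : s.arr 1 (s.int 4) = s.int 9 := h10
    rw [h4, h.zero] at this
    exact (hu this).elim
  · have hu : u ∈ R := by
      rw [← h.covered, mem_set]
      intro h0
      apply h10
      change s.arr 1 (s.int 4) = s.int 9
      rw [h4, h.zero, h0]
    obtain ⟨u', v', hu', hv', hadj⟩ := hadj
    obtain rfl : u' = u := Fin.ext (hu'.trans h4)
    obtain rfl : v' = v := Fin.ext (hv'.trans h5)
    refine .instr ⟨insert v' R, ?_, h3, h4, h5, .insert_of_adj hu hadj,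
      fun _ _ => Finset.mem_insert_self _ _⟩
    refine ⟨h.size, h.bound, h.round, h.count, h.one, h.zero, ?_, ?_⟩
    · rw [set_store_of_ne zero_ne_one]
      exact h.selected
    · rw [set_store_insert (s := (Instr.load 10 1 4).run f s) (i := 5) (v := v') h5]
      · rw [← h.covered]
        rfl
      · change s.int 8 ≠ 0
        rw [h.one]
        exact one_ne_zero
  · refine .instr ⟨R, hrep.skip, h3, h4, h5, .refl R, fun _ hc => ?_⟩
    exact (hadj ⟨u, v, h4.symm, h5.symm, hc⟩).elim

theorem halts_expand {a : ℕ} {u : Fin N} (h : Rep k t S R s) (h3 : s.int 3 = a)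
    (h4 : s.int 4 = u) :
    Halts G f (forLoop 5 expandBody) s (N * 6 + 2) fun s' => ∃ R', Rep k t S R' s' ∧
      s'.int 3 = a ∧ s'.int 4 = u ∧ Expands G R R' ∧ (u ∈ R → ∀ v, G.Adj u v → v ∈ R') := by
  refine (Halts.forLoop (T := 4) (fun j s => ∃ R', Rep k t S R' s ∧ s.int 3 = a ∧ s.int 4 = u ∧
    s.int 5 = j ∧ Expands G R R' ∧ (u ∈ R → ∀ v : Fin N, v.val < j → G.Adj u v → v ∈ R'))
    ?_ ?_ ?_).mono le_rfl ?_
  · exact ⟨R, h.congr, h3, h4, rfl, .refl R, fun _ v hv => (Nat.not_lt_zero _ hv).elim⟩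
  · rintro j s ⟨R', h, -, -, h5, -⟩
    exact ⟨h5, h.size⟩
  · rintro j hj s ⟨R₁, h, h3, h4, h5, hE, hA⟩
    refine (halts_expandBody (v := ⟨j, hj⟩) h h3 h4 h5).mono le_rfl ?_
    rintro s' ⟨R₂, h', h3', h4', h5', hE', hA'⟩
    refine ⟨R₂, h'.congr, h3', h4', congrArg Nat.succ h5', hE.trans hE', fun hu v hv hadj => ?_⟩
    rcases Nat.lt_succ_iff_lt_or_eq.1 hv with hv | hv
    · exact hE'.1 (hA hu v hv hadj)
    · obtain rfl : v = ⟨j, hj⟩ := Fin.ext hv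
      exact hA' (hE.1 hu) hadj
  · rintro s' ⟨R', h', h3', h4', -, hE, hA⟩
    exact ⟨R', h', h3', h4', hE, fun hu v => hA hu v v.2⟩

/-- The covered set may grow during the sweep, so only the neighbours of the initial set are
guaranteed to be added. -/
theorem halts_sweep {a : ℕ} (h : Rep k t S R s) (h3 : s.int 3 = a) :
    Halts G f sweep s (N * (N * 6 + 4) + 2) fun s' => ∃ R', Rep k t S R' s' ∧ s'.int 3 = a ∧
      Expands G R R' ∧ ∀ u ∈ R, ∀ v, G.Adj u v → v ∈ R' := by
  refine (Halts.forLoop (T := N * 6 + 2) (fun j s => ∃ R', Rep k t S R' s ∧ s.int 3 = a ∧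
    s.int 4 = j ∧ Expands G R R' ∧
      ∀ u : Fin N, u.val < j → u ∈ R → ∀ v, G.Adj u v → v ∈ R') ?_ ?_ ?_).mono le_rfl ?_
  · exact ⟨R, h.congr, h3, rfl, .refl R, fun v hv => (Nat.not_lt_zero _ hv).elim⟩
  · rintro j s ⟨R', h, -, h4, -⟩
    exact ⟨h4, h.size⟩
  · rintro j hj s ⟨R₁, h, h3, h4, hE, hA⟩
    refine (halts_expand (u := ⟨j, hj⟩) h h3 h4).mono le_rfl ?_
    rintro s' ⟨R₂, h', h3', h4', hE', hA'⟩
    refine ⟨R₂, h'.congr, h3', congrArg Nat.succ h4', hE.trans hE', fun u hu huR v hadj => ?_⟩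
    rcases Nat.lt_succ_iff_lt_or_eq.1 hu with hu | hu
    · exact hE'.1 (hA u hu huR v hadj)
    · obtain rfl : u = ⟨j, hj⟩ := Fin.ext hu
      exact hA' (hE.1 huR) v hadj
  · rintro s' ⟨R', h', h3', -, hE, hA⟩
    exact ⟨R', h', h3', hE, fun u => hA u u.2⟩

theorem halts_close (h : Rep k t S R s) :
    Halts G f close s (N * (N * (N * 6 + 4) + 4) + 2) fun s' => ∃ R', Rep k t S R' s' ∧
      Expands G R R' ∧ IsClosedUnderAdj G R' := by
  refine (Halts.forLoop (T := N * (N * 6 + 4) + 2) (fun j s => ∃ R', Rep k t S R' s ∧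
    -- A sweep that adds nothing certifies closure; otherwise the set grows. Thus after `N` sweeps
    -- it is closed or contains all nodes.
    s.int 3 = j ∧ Expands G R R' ∧ (IsClosedUnderAdj G R' ∨ j ≤ R'.card)) ?_ ?_ ?_).mono le_rfl ?_
  · exact ⟨R, h.congr, rfl, .refl R, Or.inr (Nat.zero_le _)⟩
  · rintro j s ⟨R', h, h3, -⟩
    exact ⟨h3, h.size⟩
  · rintro j hj s ⟨R₁, h, h3, hE, hC⟩
    refine (halts_sweep h h3).mono le_rfl ?_
    rintro s' ⟨R₂, h', h3', hE', hA⟩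
    refine ⟨R₂, h'.congr, congrArg Nat.succ h3', hE.trans hE', ?_⟩
    by_cases heq : R₁ = R₂
    · subst heq
      exact Or.inl hA
    · rcases hC with hC | hC
      · exact (heq (hC.eq_of_expands hE').symm).elim
      · have := Finset.card_lt_card (hE'.1.ssubset_of_ne heq)
        exact Or.inr (by omega)
  · rintro s' ⟨R', h', -, hE, hC⟩
    refine ⟨R', h', hE, ?_⟩
    rcases hC with hC | hC
    · exact hC
    · have : R' = Finset.univ := by
        rw [← Finset.card_eq_iff_eq_univ, Fintype.card_fin]
        exact le_antisymm (by simpa using Finset.card_le_univ R') hC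
      intro u _ v _
      rw [this]
      exact Finset.mem_univ v

/-! ### The two phases -/

/-- The selected node is added to the selected set. -/
theorem Rep.store_selected {v : Fin N} (h : Rep k t S R s) (h6 : s.int 6 = v) (hv : v ∉ S) :
    Rep k t (insert v S) R ((Instr.succ 7).run f ((Instr.store 0 6 8).run f s)) := by
  refine ⟨h.size, h.bound, h.round, ?_, h.one, h.zero, ?_, ?_⟩
  · rw [Finset.card_insert_of_notMem hv]
    exact congrArg Nat.succ h.count
  · rw [← h.selected]
    exact set_store_insert (f := f) (a := 0) h6 (by rw [h.one]; exact one_ne_zero)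
  · rw [← h.covered]
    exact set_store_of_ne (f := f) (a := 0) (i := 6) (x := 8) one_ne_zero

theorem Rep.store_both {v : Fin N} (h : Rep k t S R s) (h6 : s.int 6 = v) (hv : v ∉ S) :
    Rep k t (insert v S) (insert v R) ((Instr.succ 7).run f
      ((Instr.store 1 6 8).run f ((Instr.store 0 6 8).run f s))) := by
  have h8 : s.int 8 ≠ 0 := by
    rw [h.one]
    exact one_ne_zero
  refine ⟨h.size, h.bound, h.round, ?_, h.one, h.zero, ?_, ?_⟩
  · rw [Finset.card_insert_of_notMem hv]
    exact congrArg Nat.succ h.count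
  · rw [← h.selected]
    exact (set_store_of_ne (f := f) (s := (Instr.store 0 6 8).run f s) (a := 1) (i := 6) (x := 8)
      zero_ne_one).trans
      (set_store_insert h6 h8)
  · rw [← h.covered]
    refine (set_store_insert (f := f) (a := 1) (s := (Instr.store 0 6 8).run f s) h6 h8).trans ?_
    rw [set_store_of_ne one_ne_zero]

theorem Rep.succ_round (h : Rep k t S R s) : Rep k (t + 1) S R ((Instr.succ 2).run f s) :=
  ⟨h.size, h.bound, congrArg Nat.succ h.round, h.count, h.one, h.zero, h.selected, h.covered⟩

theorem Rep.zero_round (h : Rep k t S R s) : Rep k 0 S R ((Instr.zero 2).run f s) :=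
  ⟨h.size, h.bound, rfl, h.count, h.one, h.zero, h.selected, h.covered⟩

open scoped Classical in
/-- The invariant of the first phase. -/
structure CoverInv (G : SimpleGraph (Fin N)) (f : Finset (Fin N) → ℝ) (S R : Finset (Fin N)) :
    Prop where
  subset : S ⊆ R
  closed : IsClosedUnderAdj G R
  reachable : ∀ v ∈ R, ∃ s ∈ S, G.Reachable s v
  injOn : Set.InjOn G.connectedComponentMk S
  decay : GreedyDecay f G.connectedComponentMk S

open scoped Classical in
-- Since `R` is closed, the component of `v` is disjoint from `R`. So it was not yet met, and all
-- its nodes were candidates, which makes `v` best in its block.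
theorem CoverInv.insert_best (hf : IsMonotoneSubmodular f)
    (hs : IsBlockSeparable f G.connectedComponentMk) (h : CoverInv G f S R) {v : Fin N}
    (hv : v ∉ R) (hbest : ∀ u, u ∉ R → f (insert u S) ≤ f (insert v S))
    {R' : Finset (Fin N)} (hE : Expands G (insert v R) R') (hC : IsClosedUnderAdj G R') :
    CoverInv G f (insert v S) R' := by
  have hne : ∀ u ∈ R, G.connectedComponentMk u ≠ G.connectedComponentMk v := fun u hu huv =>
    hv (h.closed.mem_of_reachable hu (SimpleGraph.ConnectedComponent.exact huv))
  have hvS : v ∉ S := fun hc => hv (h.subset hc)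
  refine ⟨(Finset.insert_subset_insert v h.subset).trans hE.1, hC, fun w hw => ?_, ?_, ?_⟩
  · obtain ⟨u, hu, huw⟩ := hE.2 w hw
    rcases Finset.mem_insert.1 hu with rfl | hu
    · exact ⟨u, Finset.mem_insert_self _ _, huw⟩
    · obtain ⟨s, hs, hsu⟩ := h.reachable u hu
      exact ⟨s, Finset.mem_insert_of_mem hs, hsu.trans huw⟩
  · rw [Finset.coe_insert, Set.injOn_insert (by exact_mod_cast hvS)]
    refine ⟨h.injOn, ?_⟩
    rintro ⟨u, hu, huv⟩
    exact hne u (h.subset hu) huv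
  · convert h.decay.insert_best hf hs hvS fun u hu => hbest u fun huR => hne u huR hu

open scoped Classical in
-- Every round covers a new node unless all are covered, so `N` rounds suffice.
theorem halts_coverRound (hf : IsMonotoneSubmodular f)
    (hs : IsBlockSeparable f G.connectedComponentMk) (ht : t < N) (h : Rep k t S R s)
    (hI : CoverInv G f S R) (hcard : t ≤ R.card) :
    Halts G f coverRound s (N * 11 + 3 + (N * (N * (N * 6 + 4) + 4) + 2 + 4)) fun s' =>
      ∃ S R, Rep k t S R s' ∧ CoverInv G f S R ∧ t + 1 ≤ R.card := by
  refine (halts_select h (fun _ h => h.covered) hI.subset).seq ?_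
  rintro s' ⟨h', ⟨h6, hR⟩ | ⟨v, h6, hv, hbest⟩⟩
  · refine .cond (fun hc => ?_) fun _ => .instr ⟨S, R, h'.skip, hI, ?_⟩
    · have hc' : s'.int 6 < s'.int 0 := hc
      rw [h6, h'.size] at hc'
      exact (lt_irrefl _ hc').elim
    · rw [hR, Finset.card_univ, Fintype.card_fin]
      exact ht
  · refine .cond (fun _ => ?_) fun hc => ?_
    · refine .instr_seq (.instr_seq (.instr_seq ((halts_close
        (h'.store_both h6 fun hc => hv (hI.subset hc))).mono le_rfl ?_)))
      rintro s'' ⟨R', h'', hE, hC⟩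
      refine ⟨_, R', h'', hI.insert_best hf hs hv hbest hE hC, ?_⟩
      have := Finset.card_le_card hE.1
      rw [Finset.card_insert_of_notMem hv] at this
      omega
    · refine (hc ?_).elim
      change s'.int 6 < s'.int 0
      rw [h6, h'.size]
      exact v.2

open scoped Classical in
/-- The invariant of the second phase, which starts with `m` selected nodes. -/
structure FillInv (G : SimpleGraph (Fin N)) (f : Finset (Fin N) → ℝ) (k m t : ℕ)
    (S : Finset (Fin N)) : Prop where
  reachable : ∀ v, ∃ s ∈ S, G.Reachable s v
  decay : GreedyDecay f G.connectedComponentMk S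
  balance : GreedyBalance f G.connectedComponentMk S
  card_le : m ≤ k → S.card ≤ k
  le_card : min k t ≤ S.card

open scoped Classical in
theorem FillInv.insert_best (hf : IsMonotoneSubmodular f)
    (hs : IsBlockSeparable f G.connectedComponentMk) {m : ℕ} (h : FillInv G f k m t S)
    (hk : S.card < k) {v : Fin N} (hv : v ∉ S)
    (hbest : ∀ u, u ∉ S → f (insert u S) ≤ f (insert v S)) :
    FillInv G f k m (t + 1) (insert v S) := by
  have hbest' : ∀ u, f (insert u S) ≤ f (insert v S) := by
    intro u
    by_cases hu : u ∈ S
    · rw [Finset.insert_eq_of_mem hu]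
      exact hf.mono _ _ (Finset.subset_insert _ _)
    · exact hbest u hu
  have hdecay : GreedyDecay f G.connectedComponentMk (insert v S) :=
    h.decay.insert_best hf hs hv fun u _ => hbest' u
  have hle := h.le_card
  refine ⟨fun w => ?_, ?_, ?_, fun _ => ?_, ?_⟩
  · obtain ⟨s, hs, hsw⟩ := h.reachable w
    exact ⟨s, Finset.mem_insert_of_mem hs, hsw⟩
  · exact hdecay
  · exact h.balance.insert_best hf hs hdecay hv hbest'
  · rw [Finset.card_insert_of_notMem hv]
    exact hk
  · rw [Finset.card_insert_of_notMem hv]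
    omega

open scoped Classical in
theorem halts_fillRound (hf : IsMonotoneSubmodular f)
    (hs : IsBlockSeparable f G.connectedComponentMk) {m : ℕ} (ht : t < N) (h : Rep k t S R s)
    (hI : FillInv G f k m t S) :
    Halts G f fillRound s (N * 11 + 3 + 3 + 1) fun s' =>
      ∃ S R, Rep k t S R s' ∧ FillInv G f k m (t + 1) S := by
  refine .cond (fun hk => ?_) fun hk => ?_
  · have hk' : s.int 7 < s.int 1 := hk
    rw [h.count, h.bound] at hk'
    refine (halts_select h (fun _ h => h.selected) subset_rfl).seq (T' := 3) ?_
    rintro s' ⟨h', ⟨h6, hS⟩ | ⟨v, h6, hv, hbest⟩⟩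
    · refine .cond (fun hc => ?_) fun _ => .instr ⟨S, R, h'.skip, hI.reachable, hI.decay,
        hI.balance, hI.card_le, ?_⟩
      · have hc' : s'.int 6 < s'.int 0 := hc
        rw [h6, h'.size] at hc'
        exact (lt_irrefl _ hc').elim
      -- With no candidate left all `N` nodes are selected, and `t + 1 ≤ N`.
      · have : S.card = N := by rw [hS, Finset.card_univ, Fintype.card_fin]
        omega
    · refine .cond (fun _ => ?_) fun hc => ?_
      · exact .instr_seq (.instr ⟨_, R, h'.store_selected h6 hv,
          hI.insert_best hf hs hk' hv hbest⟩)
      · refine (hc ?_).elim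
        change s'.int 6 < s'.int 0
        rw [h6, h'.size]
        exact v.2
  · have hk' : ¬ s.int 7 < s.int 1 := hk
    rw [h.count, h.bound] at hk'
    exact .instr ⟨S, R, h.skip, hI.reachable, hI.decay, hI.balance, hI.card_le, by omega⟩

end

/-! ### The complete algorithm and its guarantee -/

open scoped Classical in
theorem halts_greedy (hf : IsMonotoneSubmodular f)
    (hs : IsBlockSeparable f G.connectedComponentMk) (k : ℕ) :
    Halts G f greedy (initial N k)
      (N * (N * 11 + 3 + (N * (N * (N * 6 + 4) + 4) + 2 + 4) + 2) + 2 +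
        (N * (N * 11 + 3 + 3 + 1 + 2) + 2) + 1)
      fun s' => ∃ S₀ : Finset (Fin N), Set.InjOn G.connectedComponentMk S₀ ∧
        FillInv G f k S₀.card N (s'.set N 0) := by
  have hinit : Rep k 0 (∅ : Finset (Fin N)) ∅ ((Instr.succ 8).run f (initial N k)) := by
    refine ⟨rfl, rfl, rfl, rfl, rfl, rfl, ?_, ?_⟩ <;> ext v <;>
      simp [mem_set, Instr.run, initial]
  refine .instr_seq (.seq (Halts.forLoop (fun j s => ∃ S R, Rep k j S R s ∧ CoverInv G f S R ∧
    j ≤ R.card) ?_ ?_ fun j hj s hI => ?_) ?_)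
  · refine ⟨∅, ∅, hinit.zero_round, ⟨subset_rfl, ?_, ?_, ?_, ?_⟩, le_rfl⟩
    · simp [IsClosedUnderAdj]
    · simp
    · simp
    · exact greedyDecay_empty _ _
  · rintro j s ⟨S, R, h, -⟩
    exact ⟨h.round, h.size⟩
  · obtain ⟨S, R, h, hI, hcard⟩ := hI
    refine (halts_coverRound hf hs hj h hI hcard).mono le_rfl ?_
    rintro s' ⟨S', R', h', hI', hcard'⟩
    exact ⟨S', R', h'.succ_round, hI', hcard'⟩
  · rintro s₁ ⟨S₀, R₀, h₀, hI₀, hcard₀⟩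
    have hR₀ : R₀ = Finset.univ := by
      rw [← Finset.card_eq_iff_eq_univ, Fintype.card_fin]
      exact le_antisymm (by simpa using Finset.card_le_univ R₀) hcard₀
    refine (Halts.forLoop (fun j s => ∃ S R, Rep k j S R s ∧ FillInv G f k S₀.card j S)
      ?_ ?_ fun j hj s hI => ?_).mono le_rfl ?_
    · refine ⟨S₀, R₀, h₀.zero_round, fun v => hI₀.reachable v (hR₀ ▸ Finset.mem_univ v), hI₀.decay,
        hI₀.decay.balance_of_injOn hf hI₀.injOn, id, ?_⟩
      rw [Nat.min_zero]
      exact Nat.zero_le _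
    · rintro j s ⟨S, R, h, -⟩
      exact ⟨h.round, h.size⟩
    · obtain ⟨S, R, h, hI⟩ := hI
      refine (halts_fillRound hf hs hj h hI).mono le_rfl ?_
      rintro s' ⟨S', R', h', hI'⟩
      exact ⟨S', R', h'.succ_round, hI'⟩
    · rintro s' ⟨S, R, h, hI⟩
      exact ⟨S₀, hI₀.injOn, by rwa [h.selected]⟩

/-- A bound for the number of steps of the greedy algorithm. -/
noncomputable def greedyTime : Polynomial ℕ :=
  6 * .X ^ 4 + 4 * .X ^ 3 + 26 * .X ^ 2 + 20 * .X + 5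

open scoped Classical in
theorem approximates_greedy (o : EdgeOrientation G) (hf : IsMonotoneSubmodular f)
    (hs : IsBlockSeparable f G.connectedComponentMk) (k : ℕ) :
    Approximates greedy (greedyTime.eval N) (1 - 1 / Real.exp 1) G k f
      (Consensus.Feasible o k) := by
  obtain ⟨t, s, he, ht, S₀, hinj, hI⟩ := halts_greedy hf hs k
  refine ⟨t, s, he, ht.trans (le_of_eq ?_), ?_⟩
  · simp [greedyTime]
    ring
  simp only [Consensus.feasible_iff]
  rintro ⟨O, hO, hOk⟩
  -- The first phase selects one node per component, hence no more than any feasible set contains;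
  -- so it stays within `k` when the problem is feasible.
  refine ⟨⟨hI.reachable, hI.card_le (le_trans ?_ hOk)⟩, ?_⟩
  · rw [← Finset.card_image_of_injOn hinj]
    refine (Finset.card_le_card fun b _ => ?_).trans
      (Finset.card_image_le (s := O) (f := G.connectedComponentMk))
    induction b using SimpleGraph.ConnectedComponent.ind with
    | h v =>
      obtain ⟨u, hu, huv⟩ := hO v
      exact Finset.mem_image.2 ⟨u, hu, SimpleGraph.ConnectedComponent.sound huv⟩
  · rintro O' ⟨hO', hOk'⟩
    -- A feasible `O'` has at most `min k N` nodes, and the output has at least that many.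
    refine hI.balance.le_of_card_le hf hs hI.decay (fun b => ?_)
      ((le_min hOk' (by simpa using Finset.card_le_univ O')).trans hI.le_card)
    induction b using SimpleGraph.ConnectedComponent.ind with
    | h v =>
      obtain ⟨u, hu, huv⟩ := hO' v
      exact ⟨u, Finset.mem_filter.2 ⟨hu, SimpleGraph.ConnectedComponent.sound huv⟩⟩

end Machine

theorem theorem5p5 :
    (∃ (P : Machine.Prog) (p : Polynomial ℕ),
      ∀ (N : ℕ) (G : SimpleGraph (Fin N)) (o : EdgeOrientation G) (k : ℕ)
        (f : Finset (Fin N) → ℝ), IsMonotoneSubmodular f → IsSeparableOverComponents G f →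
        Machine.Approximates P (p.eval N) (1 - 1 / Real.exp 1) G k f (Consensus.Feasible o k)) ∧
    (∃ (P : Machine.Prog) (p : Polynomial ℕ),
      ∀ (N : ℕ) (G : SimpleGraph (Fin N)) (o : EdgeOrientation G), G.Preconnected →
        ∀ (k : ℕ) (f : Finset (Fin N) → ℝ), IsMonotoneSubmodular f →
        Machine.Approximates P (p.eval N) (1 - 1 / Real.exp 1) G k f (Consensus.Feasible o k)) := by
  classical
  refine ⟨⟨Machine.greedy, Machine.greedyTime, fun N G o k f hf hs => ?_⟩,
    ⟨Machine.greedy, Machine.greedyTime, fun N G o hG k f hf => ?_⟩⟩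
  · exact Machine.approximates_greedy o hf (isBlockSeparable_of_isSeparableOverComponents hs) k
  · exact Machine.approximates_greedy o hf (isBlockSeparable_of_preconnected hG f) k
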